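/- A quantum oracle is a sequence $U=(U_n)_{n\ge 0}$ of unitaries, where $U_n$ acts on $q(n)$ qubits for a fixed polynomial $q$. An oracle circuit is a circuit over the gates $H$, $T$, CNOT in which, in addition, each of $U_n$, $U_n^\dagger$, controlled-$U_n$ and controlled-$U_n^\dagger$ may be applied as a gate to any qubits. A verifier with $k$ proofs relative to $U$ is a family $(C_n)_{n\ge 0}$ of polynomial-size oracle circuits such that a deterministic polynomial-time Turing machine outputs a description of $C_n$ on input $1^n$ (indices, including the index of a queried oracle unitary, are written in unary); $C_n$ acts on $n$ input qubits, $k$ proof registers of $\mathrm{poly}(n)$ qubits each, and $\mathrm{poly}(n)$ ancilla qubits initialised to $|0\rangle$, and it accepts when one designated ancilla qubit is finally measured to be $1$. A language $L\subseteq\{0,1\}^*$ is in $\mathsf{QMA}(2)^U$ if some verifier with two proofs satisfies: for every $x\in L$ there are pure states $|\xi_1\rangle,|\xi_2\rangle$ such that on input $x$ and proof $|\xi_1\rangle\otimes|\xi_2\rangle$ it accepts with probability at least $2/3$; and for every $x\notin L$ and all pure states $|\xi_1\rangle,|\xi_2\rangle$ it accepts $x$ and $|\xi_1\rangle\otimes|\xi_2\rangle$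 with probability at most $1/3$. A language $L$ is in $\mathsf{SBQP}^U$ if there are a verifier without proofs and a polynomial $p$ such that every $x\in L$ is accepted with probability at least $2^{-p(|x|)}$ and every $x\notin L$ with probability at most $2^{-p(|x|)-1}$. Theorem. There exists a quantum oracle $U$ such that $\mathsf{QMA}(2)^U\not\supseteq\mathsf{SBQP}^U$, that is, some language is in $\mathsf{SBQP}^U$ but not in $\mathsf{QMA}(2)^U$. -/

import Mathlib

/-! Polynomial-time uniform families of quantum circuits with a quantum oracle, and the relativized
classes `QMA(k)` and `SBQP`. Amplitudes of a register with wire set `W` are indexed by the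
computational basis strings `W → Bool`. -/

namespace QOracle

noncomputable section

/-- A quantum oracle: a sequence of unitaries, the `n`-th of which acts on `qubits n` qubits,
where `qubits` is a polynomial. -/
structure QuantumOracle where
  /-- the number of qubits of the `n`-th unitary, as a polynomial in `n` -/
  qubits : Polynomial ℕ
  /-- the unitaries -/
  unitary : (n : ℕ) → Matrix.unitaryGroup (Fin (qubits.eval n) → Bool) ℂ

/-- Gates on the wire set `W`: the universal set Hadamard, `T = diag(1, exp(iπ/4))`, CNOT, and
queries to the `n`-th oracle unitary (its inverse, if `inv` is true), plain or controlled.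
Wires of one gate are distinct. -/
inductive Gate (U : QuantumOracle) (W : Type) : Type
  | had (w : W)
  | tgate (w : W)
  | cnot (c t : W) (h : c ≠ t)
  | query (inv : Bool) (n : ℕ) (w : Fin (U.qubits.eval n) ↪ W)
  | cquery (inv : Bool) (n : ℕ) (c : W) (w : Fin (U.qubits.eval n) ↪ W) (h : ∀ i, w i ≠ c)

/-- The (not necessarily normalized) pure states on the wire set `W`. -/
abbrev Amplitudes (W : Type) : Type := (W → Bool) → ℂ

/-- A pure state: a vector of norm one. -/
def IsState {W : Type} [Fintype W] [DecidableEq W] (ψ : Amplitudes W) : Prop :=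
  ∑ x, ‖ψ x‖ ^ 2 = 1

/-- The action of `M ⊗ 1`, with `M` acting on the `m` distinct wires `w 0, …, w (m - 1)`.
Here `Function.extend w y x` is the string `x` with the bits on the wires `w` replaced by `y`. -/
def applyOn {W : Type} {m : ℕ} (M : Matrix (Fin m → Bool) (Fin m → Bool) ℂ) (w : Fin m ↪ W)
    (ψ : Amplitudes W) : Amplitudes W :=
  fun x => ∑ y : Fin m → Bool, M (fun i => x (w i)) y * ψ (Function.extend w y x)

/-- The matrix of the `n`-th oracle unitary, or of its inverse. -/
def QuantumOracle.matrix (U : QuantumOracle) (inv : Bool) (n : ℕ) :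
    Matrix (Fin (U.qubits.eval n) → Bool) (Fin (U.qubits.eval n) → Bool) ℂ :=
  if inv then ((U.unitary n)⁻¹).val else (U.unitary n).val

/-- The action of a gate on amplitudes. -/
def Gate.apply {U : QuantumOracle} {W : Type} [DecidableEq W] :
    Gate U W → Amplitudes W → Amplitudes W
  | .had w, ψ => fun x =>
      (ψ (Function.update x w false) +
        (if x w then -1 else 1) * ψ (Function.update x w true)) / (Real.sqrt 2 : ℂ)
  | .tgate w, ψ => fun x => (if x w then Complex.exp (Real.pi / 4 * Complex.I) else 1) * ψ x
  | .cnot c t _, ψ => fun x => ψ (Function.update x t (xor (x t) (x c)))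
  | .query inv n w, ψ => applyOn (U.matrix inv n) w ψ
  | .cquery inv n c w _, ψ => fun x => if x c then applyOn (U.matrix inv n) w ψ x else ψ x

/-- A circuit is a list of gates, the first of which is applied first. -/
def runCircuit {U : QuantumOracle} {W : Type} [DecidableEq W] (C : List (Gate U W))
    (ψ : Amplitudes W) : Amplitudes W :=
  C.foldl (fun φ g => g.apply φ) ψ

/-- The wires of a verifier: `n` input qubits, `k` proofs of `r` qubits each, and `a + 1` ancilla
qubits, of which number `0` is the output qubit. -/
inductive Wire (k n r a : ℕ) : Type
  | input (i : Fin n)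
  | proof (j : Fin k) (i : Fin r)
  | ancilla (i : Fin (a + 1))
  deriving DecidableEq, Fintype

/-- The alphabet in which circuits are written down. -/
inductive Token : Type
  | tick | sep | input | proof | ancilla | had | tgate | cnot
  | query | queryInv | cquery | cqueryInv
  deriving DecidableEq

/-- Self-delimiting unary notation for a number. -/
def encodeNat (i : ℕ) : List Token := List.replicate i Token.tick ++ [Token.sep]

/-- The description of a wire. -/
def encodeWire {k n r a : ℕ} : Wire k n r a → List Token
  | .input i => Token.input :: encodeNat i
  | .proof j i => Token.proof :: (encodeNat j ++ encodeNat i)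
  | .ancilla i => Token.ancilla :: encodeNat i

/-- The description of a gate. The index of an oracle query is written in unary, so that only
polynomially large indices occur in polynomial-size circuits. -/
def encodeGate {U : QuantumOracle} {k n r a : ℕ} : Gate U (Wire k n r a) → List Token
  | .had w => Token.had :: encodeWire w
  | .tgate w => Token.tgate :: encodeWire w
  | .cnot c t _ => Token.cnot :: (encodeWire c ++ encodeWire t)
  | .query inv m w => (if inv then Token.queryInv else Token.query) ::
      (encodeNat m ++ (List.ofFn w).flatMap encodeWire)
  | .cquery inv m c w _ => (if inv then Token.cqueryInv else Token.cquery) ::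
      (encodeNat m ++ encodeWire c ++ (List.ofFn w).flatMap encodeWire)

/-- The description of a circuit. -/
def encodeCircuit {U : QuantumOracle} {k n r a : ℕ} (C : List (Gate U (Wire k n r a))) :
    List Token :=
  C.flatMap encodeGate

/-- A polynomial-time uniform family of polynomial-size oracle circuits that take `k` proofs:
one circuit for each input length `n`, whose description is computed from `1ⁿ` by a deterministic
polynomial-time Turing machine. -/
structure UniformFamily (U : QuantumOracle) (k : ℕ) where
  /-- the number of qubits of each proof -/
  proofLen : Polynomial ℕ
  /-- the number of ancilla qubits besides the output qubit -/
  ancillas : Polynomial ℕ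
  /-- the circuits -/
  circuit : (n : ℕ) → List (Gate U (Wire k n (proofLen.eval n) (ancillas.eval n)))
  /-- a polynomial bound on the number of gates -/
  size : Polynomial ℕ
  size_le : ∀ n, (circuit n).length ≤ size.eval n
  uniform : Nonempty (Turing.TM2ComputableInPolyTime Computability.unaryEncodeNat id
    (fun n => encodeCircuit (circuit n)))

/-- The initial state: the input qubits hold the basis state `x`, the proof registers hold the
product state `φ 0 ⊗ ⋯ ⊗ φ (k - 1)`, and all ancilla qubits are zero. -/
def initialState {k n r a : ℕ} (x : Fin n → Bool) (φ : Fin k → Amplitudes (Fin r)) :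
    Amplitudes (Wire k n r a) :=
  fun z => if (∀ i, z (.input i) = x i) ∧ (∀ i, z (.ancilla i) = false) then
    ∏ j, φ j (fun i => z (.proof j i)) else 0

/-- The probability that the output qubit is measured to be one, on input `x` and proofs `φ`. -/
def UniformFamily.acceptProb {U : QuantumOracle} {k : ℕ} (V : UniformFamily U k) (x : List Bool)
    (φ : Fin k → Amplitudes (Fin (V.proofLen.eval x.length))) : ℝ :=
  ∑ z, if z (Wire.ancilla 0) then
    ‖runCircuit (V.circuit x.length) (initialState x.get φ) z‖ ^ 2 else 0

/-- The class `QMA(k)` relative to the quantum oracle `U`. -/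
def QMA (k : ℕ) (U : QuantumOracle) : Set (Language Bool) :=
  {L | ∃ V : UniformFamily U k,
    (∀ x ∈ L, ∃ φ, (∀ j, IsState (φ j)) ∧ 2 / 3 ≤ V.acceptProb x φ) ∧
    (∀ x ∉ L, ∀ φ, (∀ j, IsState (φ j)) → V.acceptProb x φ ≤ 1 / 3)}

/-- The class `SBQP` relative to the quantum oracle `U`; there are no proofs. -/
def SBQP (U : QuantumOracle) : Set (Language Bool) :=
  {L | ∃ (V : UniformFamily U 0) (p : Polynomial ℕ),
    (∀ x ∈ L, (1 / 2 : ℝ) ^ p.eval x.length ≤ V.acceptProb x Fin.elim0) ∧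
    (∀ x ∉ L, V.acceptProb x Fin.elim0 ≤ (1 / 2 : ℝ) ^ (p.eval x.length + 1))}

end

end QOracle

/-! The oracle hides a Boolean function `O n` on `n` bits as a diagonal matrix of signs, and the
language asks whether the sum of `(-1) ^ O n y` over all `y` is nonzero. Placing a query between two
layers of Hadamard gates gives the all-zero string the amplitude `2⁻ⁿ` times this integer. The
acceptance probability is therefore at least `4⁻ⁿ` on yes-instances and exactly zero on
no-instances, an SBQP gap (`imbalanceLanguage_mem_SBQP`). The extra query bit `b` adds a sign at `y
= 0`, so that a second query can test for the all-zero string without an AND circuit over the fixed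
gate set.

Proofs do not help, because soundness is destroyed by one change of the oracle. Take a function that
is true on a set `S` of `2ⁿ⁻¹ + 1` points: it is imbalanced, but becomes balanced when any one point
of `S` is made false. If a circuit with polynomially many gates accepts some proof for this
function, the hybrid argument finds a point of `S` with small total query amplitude. Changing the
function there hardly moves the final state, so the same proof is accepted with probability above
`1/3` for a balanced function (`exists_circuitAcceptProb_update`). The only fact needed about the
proof is that the initial state has norm at most one.

One oracle that defeats all verifiers comes from the Baire category theorem. A verifier is described
by two polynomials and a polynomial-time computable function, hence by countably many data
(`countable_computableInPolyTime`). Prefix codes make the description determine the circuits, and a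
circuit reads only finitely many functions, so being fooled at one input is an open condition. The
previous argument, applied at a large length, makes it dense (`dense_interior_fooled`). -/

namespace QOracle

noncomputable section

open Polynomial

/-! ### Phase oracles of Boolean functions -/

/-- A sequence of Boolean functions, the `n`-th of which takes `n` bits. -/
abbrev BoolOracle : Type := (n : ℕ) → (Fin n → Bool) → Bool

/-- The sign `(-1)^b`. -/
def sgn (b : Bool) : ℂ := if b then -1 else 1

@[simp] lemma norm_sgn (b : Bool) : ‖sgn b‖ = 1 := by cases b <;> simp [sgn]

lemma sgn_mul_self (b : Bool) : sgn b * sgn b = 1 := by cases b <;> simp [sgn]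

lemma star_sgn (b : Bool) : star (sgn b) = sgn b := by cases b <;> simp [sgn]

lemma eval_X_add_one (n : ℕ) : (X + 1 : ℕ[X]).eval n = n + 1 := by simp

/-- The first bit of a query. -/
def flagBit {n : ℕ} (s : Fin ((X + 1 : ℕ[X]).eval n) → Bool) : Bool :=
  s (Fin.cast (eval_X_add_one n).symm 0)

/-- The bits of a query after the first one. -/
def dataBits {n : ℕ} (s : Fin ((X + 1 : ℕ[X]).eval n) → Bool) : Fin n → Bool :=
  fun i => s (Fin.cast (eval_X_add_one n).symm i.succ)

/-- The Boolean function `(b, y) ↦ g y ⊕ (b ∧ y = 0)`. -/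
def phaseBit {n : ℕ} (g : (Fin n → Bool) → Bool) (s : Fin ((X + 1 : ℕ[X]).eval n) → Bool) : Bool :=
  xor (g (dataBits s)) (flagBit s && decide (dataBits s = fun _ => false))

/-- The quantum oracle whose `n`-th unitary multiplies the basis state `|b, y⟩` of `n + 1` qubits by
`(-1) ^ (O n y ⊕ (b ∧ y = 0))`. -/
abbrev phaseOracle (O : BoolOracle) : QuantumOracle where
  qubits := X + 1
  unitary n := ⟨Matrix.diagonal fun s => sgn (phaseBit (O n) s), by
    rw [Matrix.mem_unitaryGroup_iff, Matrix.star_eq_conjTranspose, Matrix.diagonal_conjTranspose,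
      Matrix.diagonal_mul_diagonal, ← Matrix.diagonal_one]
    congr 1
    funext s
    rw [Pi.star_apply, star_sgn, sgn_mul_self]⟩

/-- A diagonal matrix of signs is its own inverse, so inverse queries need no separate treatment. -/
lemma phaseOracle_matrix (O : BoolOracle) (inv : Bool) (n : ℕ) :
    (phaseOracle O).matrix inv n = Matrix.diagonal fun s => sgn (phaseBit (O n) s) := by
  cases inv
  · rfl
  · change star (Matrix.diagonal fun s => sgn (phaseBit (O n) s)) = _
    rw [Matrix.star_eq_conjTranspose, Matrix.diagonal_conjTranspose]
    congr 1
    funext s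
    rw [Pi.star_apply, star_sgn]

lemma applyOn_diagonal {W : Type} {m : ℕ} (d : (Fin m → Bool) → ℂ) (w : Fin m ↪ W)
    (ψ : Amplitudes W) (x : W → Bool) :
    applyOn (Matrix.diagonal d) w ψ x = d (fun i => x (w i)) * ψ x := by
  unfold applyOn
  rw [Finset.sum_eq_single (fun i => x (w i))]
  · rw [Matrix.diagonal_apply_eq]
    congr 2
    funext v
    by_cases hv : ∃ i, w i = v
    · obtain ⟨i, rfl⟩ := hv
      rw [w.injective.extend_apply]
    · rw [Function.extend_apply' _ _ _ hv]
  · intro y _ hy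
    rw [Matrix.diagonal_apply_ne _ (Ne.symm hy), zero_mul]
  · simp

variable {W : Type} [DecidableEq W]

lemma apply_query (O : BoolOracle) (inv : Bool) (n : ℕ)
    (w : Fin ((phaseOracle O).qubits.eval n) ↪ W) (ψ : Amplitudes W) (x : W → Bool) :
    (Gate.query (U := phaseOracle O) inv n w).apply ψ x =
      sgn (phaseBit (O n) fun i => x (w i)) * ψ x := by
  change applyOn ((phaseOracle O).matrix inv n) w ψ x = _
  rw [phaseOracle_matrix, applyOn_diagonal]

lemma apply_cquery (O : BoolOracle) (inv : Bool) (n : ℕ) (c : W)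
    (w : Fin ((phaseOracle O).qubits.eval n) ↪ W) (h : ∀ i, w i ≠ c) (ψ : Amplitudes W)
    (x : W → Bool) :
    (Gate.cquery (U := phaseOracle O) inv n c w h).apply ψ x =
      if x c then sgn (phaseBit (O n) fun i => x (w i)) * ψ x else ψ x := by
  change (if x c then applyOn ((phaseOracle O).matrix inv n) w ψ x else ψ x) = _
  rw [phaseOracle_matrix, applyOn_diagonal]

/-- The same gate, with queries directed to another oracle. -/
def Gate.retarget {O : BoolOracle} (O' : BoolOracle) :
    Gate (phaseOracle O) W → Gate (phaseOracle O') W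
  | .had w => .had w
  | .tgate w => .tgate w
  | .cnot c t h => .cnot c t h
  | .query inv n w => .query inv n w
  | .cquery inv n c w h => .cquery inv n c w h

/-- All phase oracles have the same `qubits`, so wires typed over `O₀` also serve for `O`; this form
lets `rw` see through that identification. -/
lemma apply_retarget_query {O₀ : BoolOracle} (O : BoolOracle) (inv : Bool) (n : ℕ)
    (w : Fin ((phaseOracle O₀).qubits.eval n) ↪ W) (ψ : Amplitudes W) (x : W → Bool) :
    ((Gate.query (U := phaseOracle O₀) inv n w).retarget O).apply ψ x =
      sgn (phaseBit (O n) fun i => x (w i)) * ψ x :=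
  apply_query O inv n w ψ x

lemma apply_retarget_cquery {O₀ : BoolOracle} (O : BoolOracle) (inv : Bool) (n : ℕ) (c : W)
    (w : Fin ((phaseOracle O₀).qubits.eval n) ↪ W) (h : ∀ i, w i ≠ c) (ψ : Amplitudes W)
    (x : W → Bool) :
    ((Gate.cquery (U := phaseOracle O₀) inv n c w h).retarget O).apply ψ x =
      if x c then sgn (phaseBit (O n) fun i => x (w i)) * ψ x else ψ x :=
  apply_cquery O inv n c w h ψ x

/-- The circuit `C` with queries directed to the oracle `O`, on the initial amplitudes `ψ`. -/
def runWith {O₀ : BoolOracle} (O : BoolOracle) (C : List (Gate (phaseOracle O₀) W))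
    (ψ : Amplitudes W) : Amplitudes W :=
  runCircuit (C.map (Gate.retarget O)) ψ

@[simp] lemma runWith_nil {O₀ : BoolOracle} (O : BoolOracle) (ψ : Amplitudes W) :
    runWith O ([] : List (Gate (phaseOracle O₀) W)) ψ = ψ := rfl

@[simp] lemma runWith_cons {O₀ : BoolOracle} (O : BoolOracle) (g : Gate (phaseOracle O₀) W)
    (C : List (Gate (phaseOracle O₀) W)) (ψ : Amplitudes W) :
    runWith O (g :: C) ψ = runWith O C ((g.retarget O).apply ψ) := rfl

/-- A circuit queries only finitely many of the functions of an oracle. -/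
lemma exists_runWith_eq {O₀ : BoolOracle} (C : List (Gate (phaseOracle O₀) W)) :
    ∃ M : ℕ, ∀ O O' : BoolOracle, (∀ m < M, O m = O' m) → runWith O C = runWith O' C := by
  induction C with
  | nil => exact ⟨0, fun O O' _ => rfl⟩
  | cons g C ih =>
    obtain ⟨M, hM⟩ := ih
    have key : ∃ M' : ℕ, ∀ O O' : BoolOracle, (∀ m < M', O m = O' m) →
        (g.retarget O).apply = (g.retarget O').apply := by
      cases g with
      | had w => exact ⟨0, fun _ _ _ => rfl⟩
      | tgate w => exact ⟨0, fun _ _ _ => rfl⟩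
      | cnot c t h => exact ⟨0, fun _ _ _ => rfl⟩
      | query inv n w =>
        refine ⟨n + 1, fun O O' h => ?_⟩
        funext ψ x
        rw [apply_retarget_query, apply_retarget_query, h n n.lt_succ_self]
      | cquery inv n c w hc =>
        refine ⟨n + 1, fun O O' h => ?_⟩
        funext ψ x
        rw [apply_retarget_cquery, apply_retarget_cquery, h n n.lt_succ_self]
    obtain ⟨M', hM'⟩ := key
    refine ⟨max M M', fun O O' h => ?_⟩
    funext ψ
    rw [runWith_cons, runWith_cons, hM O O' fun m hm => h m (lt_max_of_lt_left hm),
      hM' O O' fun m hm => h m (lt_max_of_lt_right hm)]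

/-! ### Gates are linear isometries -/

lemma apply_sub {O : BoolOracle} (g : Gate (phaseOracle O) W) (ψ φ : Amplitudes W) :
    g.apply (ψ - φ) = g.apply ψ - g.apply φ := by
  funext x
  cases g with
  | had w => simp only [Gate.apply, Pi.sub_apply]; ring
  | tgate w => simp only [Gate.apply, Pi.sub_apply]; ring
  | cnot c t h => rfl
  | query inv n w => simp only [apply_query, Pi.sub_apply]; ring
  | cquery inv n c w h =>
    simp only [apply_cquery, Pi.sub_apply]
    split_ifs
    · ring
    · rfl

variable [Fintype W]

/-- The Euclidean norm of amplitudes. -/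
def l2norm (ψ : Amplitudes W) : ℝ := ‖(WithLp.toLp 2 ψ : EuclideanSpace ℂ (W → Bool))‖

lemma l2norm_nonneg (ψ : Amplitudes W) : 0 ≤ l2norm ψ := norm_nonneg _

lemma l2norm_sq (ψ : Amplitudes W) : l2norm ψ ^ 2 = ∑ x, ‖ψ x‖ ^ 2 :=
  EuclideanSpace.norm_sq_eq _

lemma l2norm_sub_le (ψ φ χ : Amplitudes W) :
    l2norm (ψ - χ) ≤ l2norm (ψ - φ) + l2norm (φ - χ) := by
  unfold l2norm
  rw [WithLp.toLp_sub, WithLp.toLp_sub, WithLp.toLp_sub]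
  exact norm_sub_le_norm_sub_add_norm_sub _ _ _

lemma l2norm_le_add_sub (ψ φ : Amplitudes W) : l2norm ψ ≤ l2norm φ + l2norm (ψ - φ) := by
  unfold l2norm
  rw [WithLp.toLp_sub]
  exact norm_le_norm_add_norm_sub' _ _

lemma l2norm_mono {ψ φ : Amplitudes W} (h : ∀ x, ‖ψ x‖ ≤ ‖φ x‖) : l2norm ψ ≤ l2norm φ := by
  rw [← abs_of_nonneg (l2norm_nonneg ψ), ← abs_of_nonneg (l2norm_nonneg φ), ← sq_le_sq,
    l2norm_sq, l2norm_sq]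
  gcongr with x
  exact h x

omit [Fintype W] in
lemma update_not_involutive (w : W) :
    Function.Involutive fun x : W → Bool => Function.update x w (!x w) := by
  intro x
  simp

-- The gate mixes only the two strings that differ at `w`, and the parallelogram law preserves their
-- joint weight.
omit [Fintype W] in
lemma had_pair {O : BoolOracle} (w : W) (ψ : Amplitudes W) (x : W → Bool) :
    ‖(Gate.had (U := phaseOracle O) w).apply ψ x‖ ^ 2 +
      ‖(Gate.had (U := phaseOracle O) w).apply ψ (Function.update x w (!x w))‖ ^ 2 =
    ‖ψ x‖ ^ 2 + ‖ψ (Function.update x w (!x w))‖ ^ 2 := by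
  have h2 : (‖(Real.sqrt 2 : ℂ)‖ : ℝ) ^ 2 = 2 := by
    rw [Complex.norm_real, Real.norm_eq_abs, sq_abs, Real.sq_sqrt (by norm_num)]
  have par : ∀ a b : ℂ, ‖a + b‖ ^ 2 + ‖a - b‖ ^ 2 = 2 * (‖a‖ ^ 2 + ‖b‖ ^ 2) := fun a b => by
    have := parallelogram_law_with_norm ℂ a b
    nlinarith
  have key := par (ψ (Function.update x w false)) (ψ (Function.update x w true))
  cases hx : x w
  · have e : Function.update x w false = x := by rw [← hx, Function.update_eq_self]
    simp only [Gate.apply, Function.update_idem, Function.update_self, hx, Bool.not_false, e]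
    rw [e] at key
    rw [norm_div, norm_div, div_pow, div_pow, h2]
    simp only [Bool.false_eq_true, if_false, if_true, one_mul, neg_mul, ← sub_eq_add_neg]
    linarith
  · have e : Function.update x w true = x := by rw [← hx, Function.update_eq_self]
    simp only [Gate.apply, Function.update_idem, Function.update_self, hx, Bool.not_true, e]
    rw [e] at key
    rw [norm_div, norm_div, div_pow, div_pow, h2]
    simp only [Bool.false_eq_true, if_false, if_true, one_mul, neg_mul, ← sub_eq_add_neg]
    linarith

lemma l2norm_apply {O : BoolOracle} (g : Gate (phaseOracle O) W) (ψ : Amplitudes W) :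
    l2norm (g.apply ψ) = l2norm ψ := by
  have of_norm : (∀ x, ‖g.apply ψ x‖ = ‖ψ x‖) → l2norm (g.apply ψ) = l2norm ψ := fun h =>
    le_antisymm (l2norm_mono fun x => (h x).le) (l2norm_mono fun x => (h x).ge)
  cases g with
  | tgate w =>
    apply of_norm
    intro x
    have : ‖Complex.exp (Real.pi / 4 * Complex.I)‖ = 1 := by
      rw [show (Real.pi / 4 * Complex.I : ℂ) = ((Real.pi / 4 : ℝ) : ℂ) * Complex.I by push_cast; ring,
        Complex.norm_exp_ofReal_mul_I]
    simp only [Gate.apply]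
    split_ifs <;> simp [this]
  | query inv n w =>
    apply of_norm
    intro x
    rw [apply_query, norm_mul, norm_sgn, one_mul]
  | cquery inv n c w h =>
    apply of_norm
    intro x
    rw [apply_cquery]
    split_ifs <;> simp
  | cnot c t h =>
    have inv : Function.Involutive
        fun x : W → Bool => Function.update x t (xor (x t) (x c)) := by
      intro x
      simp [Function.update_of_ne h]
    rw [← sq_eq_sq₀ (l2norm_nonneg _) (l2norm_nonneg _), l2norm_sq, l2norm_sq]
    exact (Equiv.sum_comp inv.toPerm fun x => ‖ψ x‖ ^ 2)
  | had w =>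
    rw [← sq_eq_sq₀ (l2norm_nonneg _) (l2norm_nonneg _), l2norm_sq, l2norm_sq]
    have swap : ∀ F : (W → Bool) → ℝ,
        ∑ x, F (Function.update x w (!x w)) = ∑ x, F x := fun F =>
      Equiv.sum_comp (update_not_involutive w).toPerm F
    -- Summing over all strings counts every pair twice on both sides.
    have h := Finset.sum_congr rfl fun x (_ : x ∈ Finset.univ) => had_pair (O := O) w ψ x
    rw [Finset.sum_add_distrib, Finset.sum_add_distrib,
      swap fun x => ‖(Gate.had (U := phaseOracle O) w).apply ψ x‖ ^ 2,
      swap fun x => ‖ψ x‖ ^ 2] at h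
    linarith

/-! ### The hybrid argument -/

omit [DecidableEq W] [Fintype W] in
/-- The gate queries the `n`-th function at `y` in the computational basis state `x`. -/
def Gate.Reads {O : BoolOracle} {n : ℕ} (y : Fin n → Bool) :
    Gate (phaseOracle O) W → (W → Bool) → Prop
  | .query _ m w, x =>
    (⟨m, dataBits fun i => x (w i)⟩ : Σ m, Fin m → Bool) = ⟨n, y⟩
  | .cquery _ m _ w _, x =>
    (⟨m, dataBits fun i => x (w i)⟩ : Σ m, Fin m → Bool) = ⟨n, y⟩
  | _, _ => False

-- A basis string queries at most one point, so the queried parts for different points have disjoint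
-- supports. This is the source of the square-root saving in the hybrid argument.
omit [DecidableEq W] [Fintype W] in
lemma Gate.Reads.unique {O : BoolOracle} {n : ℕ} {y y' : Fin n → Bool}
    {g : Gate (phaseOracle O) W} {x : W → Bool} (h : g.Reads y x) (h' : g.Reads y' x) : y = y' := by
  cases g with
  | had w => exact h.elim
  | tgate w => exact h.elim
  | cnot c t _ => exact h.elim
  | query inv m w => exact eq_of_heq (Sigma.mk.inj (h.symm.trans h')).2
  | cquery inv m c w _ => exact eq_of_heq (Sigma.mk.inj (h.symm.trans h')).2

open scoped Classical in
/-- The part of `ψ` in which the gate queries the `n`-th function at `y`. -/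
def Gate.queried {O : BoolOracle} {n : ℕ} (g : Gate (phaseOracle O) W) (y : Fin n → Bool)
    (ψ : Amplitudes W) : Amplitudes W :=
  fun x => if g.Reads y x then ψ x else 0

/-- The sum, over the gates of a circuit, of the amplitude with which the gate queries the `n`-th
function at `y`. -/
def queryAmplitude {O₀ : BoolOracle} (O : BoolOracle) {n : ℕ} (y : Fin n → Bool) :
    List (Gate (phaseOracle O₀) W) → Amplitudes W → ℝ
  | [], _ => 0
  | g :: C, ψ => l2norm (g.queried y ψ) + queryAmplitude O y C ((g.retarget O).apply ψ)

lemma sum_l2norm_queried_sq_le {O : BoolOracle} {n : ℕ} (g : Gate (phaseOracle O) W)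
    (ψ : Amplitudes W) (S : Finset (Fin n → Bool)) :
    ∑ y ∈ S, l2norm (g.queried y ψ) ^ 2 ≤ l2norm ψ ^ 2 := by
  classical
  simp only [l2norm_sq]
  rw [Finset.sum_comm]
  gcongr with x
  by_cases h : ∃ y ∈ S, g.Reads y x
  · obtain ⟨y, hy, hr⟩ := h
    rw [Finset.sum_eq_single_of_mem y hy]
    · simp [Gate.queried, hr]
    · intro y' _ hne
      have : ¬ g.Reads y' x := fun h' => hne (h'.unique hr)
      simp [Gate.queried, this]
  · rw [Finset.sum_eq_zero]
    · positivity
    · intro y hy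
      have : ¬ g.Reads y x := fun h' => h ⟨y, hy, h'⟩
      simp [Gate.queried, this]

/-- Cauchy–Schwarz turns the bound on the squares into a factor `√|S|` instead of `|S|`. -/
lemma sum_l2norm_queried_le {O : BoolOracle} {n : ℕ} (g : Gate (phaseOracle O) W)
    (ψ : Amplitudes W) (S : Finset (Fin n → Bool)) :
    ∑ y ∈ S, l2norm (g.queried y ψ) ≤ √S.card * l2norm ψ := by
  have h := sq_sum_le_card_mul_sum_sq (s := S) (f := fun y => l2norm (g.queried y ψ))
  have h' := sum_l2norm_queried_sq_le g ψ S
  refine abs_le_of_sq_le_sq' ?_ (by have := l2norm_nonneg ψ; positivity) |>.2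
  rw [mul_pow, Real.sq_sqrt (by positivity)]
  exact h.trans (by gcongr)

lemma sum_queryAmplitude_le {O₀ : BoolOracle} (O : BoolOracle) {n : ℕ}
    (C : List (Gate (phaseOracle O₀) W)) (ψ : Amplitudes W) (S : Finset (Fin n → Bool)) :
    ∑ y ∈ S, queryAmplitude O y C ψ ≤ C.length * (√S.card * l2norm ψ) := by
  induction C generalizing ψ with
  | nil => simp [queryAmplitude]
  | cons g C ih =>
    simp only [queryAmplitude, Finset.sum_add_distrib, List.length_cons, Nat.cast_add, Nat.cast_one]
    have h1 := sum_l2norm_queried_le g ψ S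
    have h2 := ih ((g.retarget O).apply ψ)
    rw [l2norm_apply] at h2
    linarith

omit [Fintype W] in
lemma phase_sub_phase {n : ℕ} (O : BoolOracle) (y : Fin n → Bool) (b : Bool) {m : ℕ}
    (s : Fin ((X + 1 : ℕ[X]).eval m) → Bool)
    (h : (⟨m, dataBits s⟩ : Σ m, Fin m → Bool) ≠ ⟨n, y⟩) :
    phaseBit (Function.update O n (Function.update (O n) y b) m) s = phaseBit (O m) s := by
  rcases eq_or_ne m n with rfl | hm
  · have : dataBits s ≠ y := fun e => h (by rw [e])
    unfold phaseBit
    rw [Function.update_self, Function.update_of_ne this]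
  · rw [Function.update_of_ne hm]

/-- The two gates differ only on strings that query `y`, and there by at most a sign, which costs
twice the amplitude. -/
lemma l2norm_apply_update_sub_le {O₀ : BoolOracle} (O : BoolOracle) {n : ℕ} (y : Fin n → Bool)
    (b : Bool) (g : Gate (phaseOracle O₀) W) (ψ : Amplitudes W) :
    l2norm ((g.retarget O).apply ψ -
      (g.retarget (Function.update O n (Function.update (O n) y b))).apply ψ) ≤
      2 * l2norm (g.queried y ψ) := by
  have h2 : 2 * l2norm (g.queried y ψ) = l2norm ((2 : ℂ) • g.queried y ψ) := by
    unfold l2norm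
    rw [WithLp.toLp_smul, norm_smul]
    norm_num
  have tri : ∀ (c d : Bool) (z : ℂ), ‖sgn c * z - sgn d * z‖ ≤ ‖(2 : ℂ) * z‖ := fun c d z => by
    refine (norm_sub_le _ _).trans ?_
    simp only [norm_mul, norm_sgn, Complex.norm_ofNat]
    linarith
  rw [h2]
  apply l2norm_mono
  intro x
  simp only [Pi.sub_apply, Pi.smul_apply, Gate.queried, smul_eq_mul]
  cases g with
  | had w => simp [Gate.retarget, Gate.apply]
  | tgate w => simp [Gate.retarget, Gate.apply]
  | cnot c t h => simp [Gate.retarget, Gate.apply]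
  | query inv m w =>
    rw [apply_retarget_query, apply_retarget_query]
    split_ifs with h
    · exact tri _ _ _
    · rw [phase_sub_phase O y b (fun i => x (w i)) h]
      simp
  | cquery inv m c w hc =>
    rw [apply_retarget_cquery, apply_retarget_cquery]
    by_cases hx : x c
    · simp only [hx, if_true]
      split_ifs with h
      · exact tri _ _ _
      · rw [phase_sub_phase O y b (fun i => x (w i)) h]
        simp
    -- With the control off the gates agree, even if `Reads` counts this string; an upper bound is
    -- enough.
    · simp only [hx]
      simp

/-- Changing the oracle in one point changes the final state by at most twice the amplitude with
which this point is queried. -/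
lemma l2norm_runWith_update_sub_le {O₀ : BoolOracle} (O : BoolOracle) {n : ℕ} (y : Fin n → Bool)
    (b : Bool) (C : List (Gate (phaseOracle O₀) W)) (ψ φ : Amplitudes W) :
    l2norm (runWith O C ψ - runWith (Function.update O n (Function.update (O n) y b)) C φ) ≤
      l2norm (ψ - φ) + 2 * queryAmplitude O y C ψ := by
  induction C generalizing ψ φ with
  | nil => simp [queryAmplitude]
  | cons g C ih =>
    set O' := Function.update O n (Function.update (O n) y b) with hO'
    simp only [runWith_cons, queryAmplitude]
    refine (ih _ _).trans ?_
    -- The intermediate state is the new gate applied to the old state: the new gate carries the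
    -- accumulated error isometrically, and the fresh error is charged to the run with the unchanged
    -- oracle.
    have h1 := l2norm_sub_le ((g.retarget O).apply ψ) ((g.retarget O').apply ψ)
      ((g.retarget O').apply φ)
    rw [← apply_sub, l2norm_apply] at h1
    have h2 := l2norm_apply_update_sub_le O y b g ψ
    rw [← hO'] at h2
    linarith

/-- Some point of a large set can be changed without the circuit noticing. -/
lemma exists_l2norm_runWith_update_sub_le {O₀ : BoolOracle} (O : BoolOracle) {n : ℕ} (b : Bool)
    (C : List (Gate (phaseOracle O₀) W)) (ψ : Amplitudes W) (S : Finset (Fin n → Bool))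
    (hS : S.Nonempty) :
    ∃ y ∈ S, l2norm (runWith O C ψ -
      runWith (Function.update O n (Function.update (O n) y b)) C ψ) * √S.card ≤
        2 * C.length * l2norm ψ := by
  have hpos : 0 < √(S.card : ℝ) := Real.sqrt_pos.2 (by exact_mod_cast hS.card_pos)
  -- Averaging: some point of `S` has at most the mean query amplitude.
  have hsum : ∑ y ∈ S, queryAmplitude O y C ψ ≤
      ∑ _y ∈ S, C.length * l2norm ψ / √S.card := by
    refine (sum_queryAmplitude_le O C ψ S).trans (le_of_eq ?_)
    rw [Finset.sum_const, nsmul_eq_mul]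
    field_simp
    rw [Real.sq_sqrt (by positivity)]
    ring
  obtain ⟨y, hy, h⟩ := Finset.exists_le_of_sum_le hS hsum
  refine ⟨y, hy, ?_⟩
  have h' := l2norm_runWith_update_sub_le O y b C ψ ψ
  have h0 : l2norm (ψ - ψ) = 0 := by simp [l2norm]
  rw [le_div_iff₀ hpos] at h
  calc _ ≤ (l2norm (ψ - ψ) + 2 * queryAmplitude O y C ψ) * √S.card := by gcongr
    _ = 2 * (queryAmplitude O y C ψ * √S.card) := by rw [h0]; ring
    _ ≤ 2 * (C.length * l2norm ψ) := by gcongr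
    _ = _ := by ring

end

end QOracle

namespace QOracle

noncomputable section

open Turing

/-! ### There are only countably many computable functions -/

section Countable

variable {K : Type} {Γ : K → Type} {Λ σ : Type}

/-- The nesting depth of a statement. -/
def stmtDepth : TM2.Stmt Γ Λ σ → ℕ
  | .push _ _ q => stmtDepth q + 1
  | .peek _ _ q => stmtDepth q + 1
  | .pop _ _ q => stmtDepth q + 1
  | .load _ q => stmtDepth q + 1
  | .branch _ q r => max (stmtDepth q) (stmtDepth r) + 1
  | .goto _ => 0
  | .halt => 0

/-- By induction on depth: a constructor combines substatements of smaller depth with functions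
between finite types. -/
instance countable_stmt [Finite K] [∀ k, Finite (Γ k)] [Finite Λ] [Finite σ] :
    Countable (TM2.Stmt Γ Λ σ) := by
  have key : ∀ n, {q : TM2.Stmt Γ Λ σ | stmtDepth q ≤ n}.Countable := by
    intro n
    induction n with
    | zero =>
      refine ((Set.countable_range fun l : σ → Λ => TM2.Stmt.goto (Γ := Γ) l).insert
        TM2.Stmt.halt).mono ?_
      rintro (_ | _ | _ | _ | _ | l | _) hq <;> simp_all [stmtDepth]
    | succ n ih =>
      have h : {q : TM2.Stmt Γ Λ σ | stmtDepth q ≤ n + 1} ⊆ {q | stmtDepth q ≤ n} ∪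
          ((⋃ p : Σ k, σ → Γ k, (fun q => TM2.Stmt.push p.1 p.2 q) '' {q | stmtDepth q ≤ n}) ∪
          (⋃ p : Σ k, σ → Option (Γ k) → σ,
            (fun q => TM2.Stmt.peek p.1 p.2 q) '' {q | stmtDepth q ≤ n}) ∪
          (⋃ p : Σ k, σ → Option (Γ k) → σ,
            (fun q => TM2.Stmt.pop p.1 p.2 q) '' {q | stmtDepth q ≤ n}) ∪
          (⋃ p : σ → σ, (fun q => TM2.Stmt.load p q) '' {q | stmtDepth q ≤ n}) ∪
          (⋃ p : σ → Bool, (fun q : _ × _ => TM2.Stmt.branch p q.1 q.2) ''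
            ({q | stmtDepth q ≤ n} ×ˢ {q | stmtDepth q ≤ n}))) := by
        rintro q hq
        cases q with
        | push k f q =>
          exact Or.inr (Or.inl (Or.inl (Or.inl (Or.inl (Set.mem_iUnion.2
            ⟨⟨k, f⟩, q, Nat.le_of_succ_le_succ hq, rfl⟩)))))
        | peek k f q =>
          exact Or.inr (Or.inl (Or.inl (Or.inl (Or.inr (Set.mem_iUnion.2
            ⟨⟨k, f⟩, q, Nat.le_of_succ_le_succ hq, rfl⟩)))))
        | pop k f q =>
          exact Or.inr (Or.inl (Or.inl (Or.inr (Set.mem_iUnion.2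
            ⟨⟨k, f⟩, q, Nat.le_of_succ_le_succ hq, rfl⟩))))
        | load f q =>
          exact Or.inr (Or.inl (Or.inr (Set.mem_iUnion.2
            ⟨f, q, Nat.le_of_succ_le_succ hq, rfl⟩)))
        | branch f q r =>
          exact Or.inr (Or.inr (Set.mem_iUnion.2 ⟨f, (q, r),
            ⟨(le_max_left _ _).trans (Nat.le_of_succ_le_succ hq),
              (le_max_right _ _).trans (Nat.le_of_succ_le_succ hq)⟩, rfl⟩))
        | goto f => exact Or.inl (Nat.zero_le _)
        | halt => exact Or.inl (Nat.zero_le _)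
      refine Set.Countable.mono h (ih.union ?_)
      refine ((((Set.countable_iUnion fun p => ih.image _).union
        (Set.countable_iUnion fun p => ih.image _)).union
        (Set.countable_iUnion fun p => ih.image _)).union
        (Set.countable_iUnion fun p => ih.image _)).union
        (Set.countable_iUnion fun p => (ih.prod ih).image _)
  rw [← Set.countable_univ_iff]
  exact (Set.countable_iUnion key).mono fun q _ => Set.mem_iUnion.2 ⟨stmtDepth q, le_refl (stmtDepth q)⟩

/-- The symbols that a statement pushes. -/
def pushedSymbols : TM2.Stmt Γ Λ σ → Set (Σ k, Γ k)
  | .push k f q => Set.range (fun v => (⟨k, f v⟩ : Σ k, Γ k)) ∪ pushedSymbols q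
  | .peek _ _ q => pushedSymbols q
  | .pop _ _ q => pushedSymbols q
  | .load _ q => pushedSymbols q
  | .branch _ q r => pushedSymbols q ∪ pushedSymbols r
  | .goto _ => ∅
  | .halt => ∅

/-- A `FinTM2` may have infinite alphabets away from the input stack, but with finitely many states
each statement writes only finitely many symbols. Only these matter for a code of the machine. -/
lemma finite_pushedSymbols [Finite σ] (q : TM2.Stmt Γ Λ σ) : (pushedSymbols q).Finite := by
  induction q with
  | push k f q ih => exact (Set.finite_range _).union ih
  | peek k f q ih => exact ih
  | pop k f q ih => exact ih
  | load f q ih => exact ih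
  | branch f q r ihq ihr => exact ihq.union ihr
  | goto f => exact Set.finite_empty
  | halt => exact Set.finite_empty

/-! ### Replacing the types of a machine by numbers. -/

/-- A renaming of stacks, labels and states by numbers, and of stack symbols, injective on a set of
symbols in use. -/
structure Renaming (Γ : K → Type) (Λ σ : Type) (a b c d : ℕ) where
  /-- the numbering of the stacks -/
  stack : K ≃ Fin a
  /-- the numbering of the states -/
  state : σ ≃ Fin b
  /-- the numbering of the labels -/
  label : Λ ≃ Fin c
  /-- the symbols in use -/
  used : Set (Σ k, Γ k)
  /-- the number of a symbol -/
  enc : (Σ k, Γ k) → Fin d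
  /-- the symbol with a given number -/
  dec : (k : K) → Fin d → Option (Γ k)
  dec_enc : ∀ k γ, ⟨k, γ⟩ ∈ used → dec k (enc ⟨k, γ⟩) = some γ

lemma exists_renaming [Finite K] [Finite Λ] [Finite σ] {used : Set (Σ k, Γ k)}
    (h : used.Finite) : ∃ (a b c d : ℕ) (R : Renaming Γ Λ σ a b c d), R.used = used := by
  classical
  obtain ⟨a, ⟨eK⟩⟩ := Finite.exists_equiv_fin K
  obtain ⟨b, ⟨eσ⟩⟩ := Finite.exists_equiv_fin σ
  obtain ⟨c, ⟨eΛ⟩⟩ := Finite.exists_equiv_fin Λ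
  have := h.to_subtype
  obtain ⟨d, ⟨e⟩⟩ := Finite.exists_equiv_fin used
  -- The spare number `d` is shared by all symbols that are not in use.
  let enc : (Σ k, Γ k) → Fin (d + 1) := fun p =>
    if hp : p ∈ used then (e ⟨p, hp⟩).castSucc else Fin.last d
  have enc_inj : ∀ p ∈ used, ∀ q ∈ used, enc p = enc q → p = q := by
    intro p hp q hq hpq
    simp only [enc, hp, hq, dif_pos] at hpq
    have := e.injective (Fin.castSucc_injective _ hpq)
    exact congrArg Subtype.val this
  refine ⟨a, b, c, d + 1, ⟨eK, eσ, eΛ, used, enc, fun k i =>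
    if h : ∃ γ : Γ k, ⟨k, γ⟩ ∈ used ∧ enc ⟨k, γ⟩ = i then some h.choose else none, ?_⟩, rfl⟩
  intro k γ hγ
  have hex : ∃ γ' : Γ k, ⟨k, γ'⟩ ∈ used ∧ enc ⟨k, γ'⟩ = enc ⟨k, γ⟩ := ⟨γ, hγ, rfl⟩
  rw [dif_pos hex]
  have := enc_inj _ hex.choose_spec.1 _ hγ hex.choose_spec.2
  congr 1
  exact eq_of_heq (Sigma.mk.inj this).2

namespace Renaming

variable {a b c d : ℕ} (R : Renaming Γ Λ σ a b c d)

/-- The renamed statement. -/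
def stmt : TM2.Stmt Γ Λ σ → TM2.Stmt (fun _ : Fin a => Fin d) (Fin c) (Fin b)
  | .push k f q => .push (R.stack k) (fun s => R.enc ⟨k, f (R.state.symm s)⟩) (stmt q)
  | .peek k f q =>
    .peek (R.stack k) (fun s o => R.state (f (R.state.symm s) (o.bind (R.dec k)))) (stmt q)
  | .pop k f q =>
    .pop (R.stack k) (fun s o => R.state (f (R.state.symm s) (o.bind (R.dec k)))) (stmt q)
  | .load f q => .load (fun s => R.state (f (R.state.symm s))) (stmt q)
  | .branch f q r => .branch (fun s => f (R.state.symm s)) (stmt q) (stmt r)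
  | .goto f => .goto fun s => R.label (f (R.state.symm s))
  | .halt => .halt

/-- The renamed stacks. -/
def stackMap (S : ∀ k, List (Γ k)) : Fin a → List (Fin d) :=
  fun i => (S (R.stack.symm i)).map fun γ => R.enc ⟨_, γ⟩

/-- The renamed configuration. -/
def cfg (C : TM2.Cfg Γ Λ σ) : TM2.Cfg (fun _ : Fin a => Fin d) (Fin c) (Fin b) :=
  ⟨C.l.map R.label, R.state C.var, R.stackMap C.stk⟩

/-- All symbols on the stacks are in use. -/
def UsesOnly (S : ∀ k, List (Γ k)) : Prop := ∀ k, ∀ γ ∈ S k, ⟨k, γ⟩ ∈ R.used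

lemma stackMap_apply (S : ∀ k, List (Γ k)) (k : K) :
    R.stackMap S (R.stack k) = (S k).map fun γ => R.enc ⟨k, γ⟩ := by
  have : ∀ j, j = k → (S j).map (fun γ => R.enc ⟨j, γ⟩) = (S k).map fun γ => R.enc ⟨k, γ⟩ := by
    rintro _ rfl; rfl
  exact this _ (R.stack.symm_apply_apply k)

variable [DecidableEq K]

lemma stackMap_update (S : ∀ k, List (Γ k)) (k : K) (l : List (Γ k)) :
    R.stackMap (Function.update S k l) =
      Function.update (R.stackMap S) (R.stack k) (l.map fun γ => R.enc ⟨k, γ⟩) := by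
  funext i
  obtain ⟨j, rfl⟩ := R.stack.surjective i
  rw [stackMap_apply]
  rcases eq_or_ne j k with rfl | h
  · rw [Function.update_self, Function.update_self]
  · rw [Function.update_of_ne h, Function.update_of_ne (R.stack.injective.ne h), stackMap_apply]

variable {R}

lemma UsesOnly.update {S : ∀ k, List (Γ k)} (hS : R.UsesOnly S) {k : K} {l : List (Γ k)}
    (hl : ∀ γ ∈ l, ⟨k, γ⟩ ∈ R.used) : R.UsesOnly (Function.update S k l) := by
  intro j γ hγ
  rcases eq_or_ne j k with rfl | h
  · rw [Function.update_self] at hγ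
    exact hl γ hγ
  · rw [Function.update_of_ne h] at hγ
    exact hS j γ hγ

omit [DecidableEq K] in
lemma UsesOnly.head?_bind {S : ∀ k, List (Γ k)} (hS : R.UsesOnly S) (k : K) :
    (R.stackMap S (R.stack k)).head?.bind (R.dec k) = (S k).head? := by
  rw [stackMap_apply, List.head?_map]
  cases h : (S k).head? with
  | none => rfl
  | some γ => exact R.dec_enc k γ (hS k γ (List.mem_of_mem_head? h))

/-- Renaming commutes with execution as long as every popped symbol can be decoded, so the induction
also carries the invariant that the stacks hold only symbols in use. -/
lemma stepAux_stmt (q : TM2.Stmt Γ Λ σ) (hq : pushedSymbols q ⊆ R.used) (v : σ)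
    (S : ∀ k, List (Γ k)) (hS : R.UsesOnly S) :
    TM2.stepAux (R.stmt q) (R.state v) (R.stackMap S) = R.cfg (TM2.stepAux q v S) ∧
      R.UsesOnly (TM2.stepAux q v S).stk := by
  induction q generalizing v S with
  | push k f q ih =>
    have hS' : R.UsesOnly (Function.update S k (f v :: S k)) := hS.update fun γ hγ => by
      rcases List.mem_cons.1 hγ with rfl | hγ
      · exact hq (Or.inl ⟨v, rfl⟩)
      · exact hS k γ hγ
    have := ih (fun x hx => hq (Or.inr hx)) v _ hS'
    rw [stackMap_update] at this
    simpa [stmt, stackMap_apply] using this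
  | peek k f q ih =>
    have := ih hq (f v (S k).head?) S hS
    simpa [stmt, hS.head?_bind] using this
  | pop k f q ih =>
    have hS' : R.UsesOnly (Function.update S k (S k).tail) := hS.update fun γ hγ =>
      hS k γ (List.mem_of_mem_tail hγ)
    have := ih hq (f v (S k).head?) _ hS'
    rw [stackMap_update] at this
    have e := hS.head?_bind k
    simp only [stmt, TM2.stepAux, Equiv.symm_apply_apply, e]
    simpa [stackMap_apply] using this
  | load f q ih => simpa [stmt] using ih hq (f v) S hS
  | branch f q r ihq ihr =>
    simp only [stmt, TM2.stepAux, Equiv.symm_apply_apply]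
    cases f v
    · exact ihr (fun x hx => hq (Or.inr hx)) v S hS
    · exact ihq (fun x hx => hq (Or.inl hx)) v S hS
  | goto f => exact ⟨by simp [stmt, cfg], hS⟩
  | halt => exact ⟨by simp [stmt, cfg], hS⟩

/-- The renamed program. -/
def program (R : Renaming Γ Λ σ a b c d) (m : Λ → TM2.Stmt Γ Λ σ) :
    Fin c → TM2.Stmt (fun _ : Fin a => Fin d) (Fin c) (Fin b) :=
  fun l => R.stmt (m (R.label.symm l))

lemma iterate_step {m : Λ → TM2.Stmt Γ Λ σ} (hm : ∀ l, pushedSymbols (m l) ⊆ R.used) (n : ℕ)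
    (C : Option (TM2.Cfg Γ Λ σ)) (hC : ∀ D ∈ C, R.UsesOnly D.stk) :
    (flip bind (TM2.step (R.program m)))^[n] (C.map R.cfg) =
      ((flip bind (TM2.step m))^[n] C).map R.cfg := by
  induction n generalizing C with
  | zero => rfl
  | succ n ih =>
    rw [Function.iterate_succ_apply, Function.iterate_succ_apply]
    rcases C with _ | ⟨_ | l, v, S⟩
    · exact ih none (by simp)
    · exact ih none (by simp)
    · have h := stepAux_stmt (m l) (hm l) v S (hC _ rfl)
      have := ih (some (TM2.stepAux (m l) v S)) (by rintro D ⟨⟩; exact h.2)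
      rw [Option.map_some, ← h.1] at this
      rw [← show (flip bind (TM2.step m)) (some ⟨some l, v, S⟩) =
        some (TM2.stepAux (m l) v S) from rfl] at this
      rw [← this]
      congr 1
      change some (TM2.stepAux (R.program m (R.label l)) _ _) = _
      simp [program]

end Renaming

/-! ### Codes of machines and countability. -/

/-- A machine whose stacks, labels, states and symbols are numbers, with an input stack and an
output stack, and the interpretation of its symbols. -/
abbrev MachineCode (α β : Type) : Type :=
  Σ a b c d : ℕ, (Fin c → TM2.Stmt (fun _ : Fin a => Fin d) (Fin c) (Fin b)) ×
    Fin c × Fin b × Fin a × Fin a × (α → Fin d) × (Fin d → Option β)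

/-- The machine outputs `t` on input `s`. -/
def MachineCode.Outputs {α β : Type} : MachineCode α β → List α → List β → Prop
  | ⟨_, _, _, _, m, main, init, i, o, enc, dec⟩, s, t => ∃ n C,
    (flip bind (TM2.step m))^[n]
      (some ⟨some main, init, fun k => if k = i then s.map enc else []⟩) = some C ∧
    C.l = none ∧ (C.stk o).map dec = t.map some

lemma iterate_bind_none {α : Type} (f : α → Option α) (n : ℕ) :
    (flip bind f)^[n] none = none := by
  induction n with
  | zero => rfl
  | succ n ih => rw [Function.iterate_succ_apply]; exact ih

/-- One step after halting the iteration becomes `none` and stays so; hence only one iterate can be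
a halting configuration. -/
lemma iterate_bind_halt_unique {α : Type} {f : α → Option α} {x : Option α} {n n' : ℕ} {y y' : α}
    (h : (flip bind f)^[n] x = some y) (h' : (flip bind f)^[n'] x = some y')
    (hy : f y = none) (hy' : f y' = none) : y = y' := by
  have key : ∀ {n n' : ℕ} {y y' : α}, n ≤ n' → (flip bind f)^[n] x = some y →
      (flip bind f)^[n'] x = some y' → f y = none → y = y' := by
    intro n n' y y' hn h h' hy
    obtain ⟨k, rfl⟩ := Nat.exists_eq_add_of_le hn
    rw [add_comm, Function.iterate_add_apply, h] at h'
    cases k with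
    | zero => exact Option.some.inj h'
    | succ k =>
      rw [Function.iterate_succ_apply, show flip bind f (some y) = f y from rfl, hy,
        iterate_bind_none] at h'
      cases h'
  rcases le_total n n' with hn | hn
  · exact key hn h h' hy
  · exact (key hn h' h hy').symm

lemma MachineCode.Outputs.unique {α β : Type} {M : MachineCode α β} {s : List α} {t t' : List β}
    (h : M.Outputs s t) (h' : M.Outputs s t') : t = t' := by
  obtain ⟨a, b, c, d, m, main, init, i, o, enc, dec⟩ := M
  obtain ⟨n, ⟨_, v, S⟩, hC, rfl, ht⟩ := h
  obtain ⟨n', ⟨_, v', S'⟩, hC', rfl, ht'⟩ := h'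
  have := iterate_bind_halt_unique hC hC' rfl rfl
  rw [← this, ht] at ht'
  exact List.map_injective_iff.2 (Option.some_injective β) ht'

lemma exists_machineCode {α αΓ βΓ : Type} [Finite βΓ] {ea : α → List αΓ} {f : α → List βΓ}
    (h : Nonempty (TM2ComputableInPolyTime ea id f)) :
    ∃ M : MachineCode αΓ βΓ, ∀ x, M.Outputs (ea x) (f x) := by
  obtain ⟨T⟩ := h
  obtain ⟨⟨tm, eI, eO⟩, time, out⟩ := T
  dsimp only at out
  have := tm.kFin
  have := tm.ΛFin
  have := tm.σFin
  have := tm.Γk₀Fin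
  have : Finite (tm.Γ tm.k₁) := Finite.of_equiv _ eO.symm
  -- The symbols in use are those the program pushes, the input alphabet, which fills the initial
  -- stack, and the output alphabet, which must be decoded.
  have hfin : ((⋃ l, pushedSymbols (tm.m l)) ∪
      (Set.range (Sigma.mk (β := tm.Γ) tm.k₀) ∪ Set.range (Sigma.mk (β := tm.Γ) tm.k₁))).Finite :=
    (Set.finite_iUnion fun l => finite_pushedSymbols _).union
      ((Set.finite_range _).union (Set.finite_range _))
  obtain ⟨a, b, c, d, R, hR⟩ := exists_renaming (Λ := tm.Λ) (σ := tm.σ) hfin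
  refine ⟨⟨a, b, c, d, R.program tm.m, R.label tm.main, R.state tm.initialState, R.stack tm.k₀,
    R.stack tm.k₁, fun s => R.enc ⟨_, eI.symm s⟩, fun i => (R.dec tm.k₁ i).map eO⟩, fun x => ?_⟩
  have hrun := (out x).evals_in_steps
  have hm : ∀ l, pushedSymbols (tm.m l) ⊆ R.used := fun l => by
    rw [hR]
    exact (Set.subset_iUnion (fun l => pushedSymbols (tm.m l)) l).trans Set.subset_union_left
  have hinit : R.UsesOnly (initList tm ((ea x).map eI.invFun)).stk := by
    intro k γ hγ
    by_cases hk : k = tm.k₀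
    · subst hk
      rw [hR]
      exact Or.inr (Or.inl ⟨γ, rfl⟩)
    · simp [initList, hk] at hγ
  have hsim := Renaming.iterate_step hm (out x).steps
    (some (initList tm ((ea x).map eI.invFun))) (by rintro D ⟨⟩; exact hinit)
  refine ⟨(out x).steps, R.cfg (haltList tm ((f x).map eO.invFun)), ?_, rfl, ?_⟩
  · refine Eq.trans ?_ (hsim.trans ?_)
    · congr 1
      simp only [Option.map_some, Renaming.cfg, initList]
      congr 2
      funext i
      obtain ⟨k, rfl⟩ := R.stack.surjective i
      rw [Renaming.stackMap_apply]
      by_cases hk : k = tm.k₀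
      · subst hk
        simp [List.map_map, Function.comp_def]
      · simp [hk]
    · exact congrArg (Option.map R.cfg) hrun
  · have hstk : (haltList tm ((f x).map eO.invFun)).stk tm.k₁ = (f x).map eO.invFun := by
      simp [haltList]
    simp only [Renaming.cfg]
    rw [Renaming.stackMap_apply, hstk, List.map_map, List.map_map]
    apply List.map_congr_left
    intro t _
    have hu : (⟨tm.k₁, eO.symm t⟩ : Σ k, tm.Γ k) ∈ R.used := by
      rw [hR]
      exact Or.inr (Or.inr ⟨_, rfl⟩)
    simp [R.dec_enc _ _ hu]

set_option synthInstance.maxHeartbeats 200000 in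
set_option synthInstance.maxSize 1000 in
instance {α β : Type} [Finite α] [Finite β] : Countable (MachineCode α β) := by
  unfold MachineCode
  infer_instance

/-- The output of a coded machine is unique, so choosing a code for each function is injective. -/
theorem countable_computableInPolyTime {α αΓ βΓ : Type} [Finite αΓ] [Finite βΓ]
    (ea : α → List αΓ) :
    {f : α → List βΓ | Nonempty (TM2ComputableInPolyTime ea id f)}.Countable := by
  have : ∀ f : {f : α → List βΓ | Nonempty (TM2ComputableInPolyTime ea id f)},
      ∃ M : MachineCode αΓ βΓ, ∀ x, M.Outputs (ea x) (f.1 x) := fun f => exists_machineCode f.2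
  choose code hcode using this
  have hinj : Function.Injective code := by
    intro f g hfg
    apply Subtype.ext
    funext x
    exact (hcode f x).unique (hfg ▸ hcode g x)
  exact Set.countable_coe_iff.1 hinj.countable

end Countable

end

end QOracle

namespace QOracle

noncomputable section

/-! ### Descriptions determine circuits -/

/-- A code in which no code word is a proper prefix of another one. -/
def IsPrefixCode {α : Type} (e : α → List Token) : Prop :=
  ∀ a b s t, e a ++ s = e b ++ t → a = b ∧ s = t

lemma isPrefixCode_encodeNat : IsPrefixCode encodeNat := by
  intro i
  induction i with
  | zero =>
    rintro (_ | j) s t h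
    · simpa [encodeNat] using h
    · simp [encodeNat, List.replicate_succ] at h
  | succ i ih =>
    rintro (_ | j) s t h
    · simp [encodeNat, List.replicate_succ] at h
    · have := ih j s t (by simpa [encodeNat, List.replicate_succ] using h)
      exact ⟨by rw [this.1], this.2⟩

lemma isPrefixCode_encodeWire {k n r a : ℕ} :
    IsPrefixCode (encodeWire : Wire k n r a → List Token) := by
  rintro (i | ⟨j, i⟩ | i) (i' | ⟨j', i'⟩ | i') s t h <;>
    simp only [encodeWire, List.cons_append, List.append_assoc, List.cons.injEq, reduceCtorEq,
      false_and, true_and] at h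
  · obtain ⟨h1, h2⟩ := isPrefixCode_encodeNat _ _ _ _ h
    exact ⟨by rw [Fin.ext h1], h2⟩
  · obtain ⟨h1, h⟩ := isPrefixCode_encodeNat _ _ _ _ h
    obtain ⟨h2, h3⟩ := isPrefixCode_encodeNat _ _ _ _ h
    exact ⟨by rw [Fin.ext h1, Fin.ext h2], h3⟩
  · obtain ⟨h1, h2⟩ := isPrefixCode_encodeNat _ _ _ _ h
    exact ⟨by rw [Fin.ext h1], h2⟩

/-- Concatenations are not self-delimiting; equal lengths are required because otherwise one list
could continue into the remainder of the other. -/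
lemma IsPrefixCode.flatMap {α : Type} {e : α → List Token} (he : IsPrefixCode e)
    (l l' : List α) (hl : l.length = l'.length) (s t : List Token)
    (h : l.flatMap e ++ s = l'.flatMap e ++ t) : l = l' ∧ s = t := by
  induction l generalizing l' with
  | nil =>
    obtain rfl : l' = [] := List.length_eq_zero_iff.1 hl.symm
    exact ⟨rfl, by simpa using h⟩
  | cons a l ih =>
    rcases l' with _ | ⟨b, l'⟩
    · simp at hl
    · simp only [List.flatMap_cons, List.append_assoc] at h
      obtain ⟨rfl, h₁⟩ := he _ _ _ _ h
      obtain ⟨rfl, h₂⟩ := ih l' (by simpa using hl) h₁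
      exact ⟨rfl, h₂⟩

lemma IsPrefixCode.ofFn {α : Type} {e : α → List Token} (he : IsPrefixCode e) {m : ℕ}
    {w w' : Fin m ↪ α} {s t : List Token}
    (h : (List.ofFn w).flatMap e ++ s = (List.ofFn w').flatMap e ++ t) : w = w' ∧ s = t := by
  obtain ⟨h1, h2⟩ := he.flatMap _ _ (by simp) _ _ h
  exact ⟨DFunLike.coe_injective (List.ofFn_injective h1), h2⟩

lemma isPrefixCode_encodeGate {U : QuantumOracle} {k n r a : ℕ} :
    IsPrefixCode (encodeGate : Gate U (Wire k n r a) → List Token) := by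
  have hw := isPrefixCode_encodeWire (k := k) (n := n) (r := r) (a := a)
  rintro (w | w | ⟨c, w, hc⟩ | ⟨i, m, w⟩ | ⟨i, m, c, w, hc⟩)
    (w' | w' | ⟨c', w', hc'⟩ | ⟨i', m', w'⟩ | ⟨i', m', c', w', hc'⟩) s t h
  case had.had =>
    obtain ⟨rfl, h₁⟩ := hw w w' s t (by simpa [encodeGate] using h)
    exact ⟨rfl, h₁⟩
  case tgate.tgate =>
    obtain ⟨rfl, h₁⟩ := hw w w' s t (by simpa [encodeGate] using h)
    exact ⟨rfl, h₁⟩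
  case cnot.cnot =>
    simp only [encodeGate, List.cons_append, List.append_assoc, List.cons.injEq, true_and] at h
    obtain ⟨rfl, h₁⟩ := hw _ _ _ _ h
    obtain ⟨rfl, h₂⟩ := hw _ _ _ _ h₁
    exact ⟨rfl, h₂⟩
  case query.query =>
    simp only [encodeGate, List.cons_append, List.append_assoc, List.cons.injEq] at h
    obtain ⟨hi, h⟩ := h
    obtain rfl : i = i' := by cases i <;> cases i' <;> simp_all
    -- The oracle index has to be identified first, since it fixes the number of wires that follow.
    obtain ⟨rfl, h₁⟩ := isPrefixCode_encodeNat _ _ _ _ h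
    obtain ⟨rfl, h₂⟩ := hw.ofFn h₁
    exact ⟨rfl, h₂⟩
  case cquery.cquery =>
    simp only [encodeGate, List.cons_append, List.append_assoc, List.cons.injEq] at h
    obtain ⟨hi, h⟩ := h
    obtain rfl : i = i' := by cases i <;> cases i' <;> simp_all
    obtain ⟨rfl, h₁⟩ := isPrefixCode_encodeNat _ _ _ _ h
    obtain ⟨rfl, h₂⟩ := hw _ _ _ _ h₁
    obtain ⟨rfl, h₃⟩ := hw.ofFn h₂
    exact ⟨rfl, h₃⟩
  all_goals
    simp only [encodeGate, List.cons_append, List.cons.injEq] at h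
    replace h := h.1
    first
      | cases h
      | split_ifs at h

lemma encodeGate_ne_nil {U : QuantumOracle} {k n r a : ℕ} (g : Gate U (Wire k n r a)) :
    encodeGate g ≠ [] := by
  cases g <;> simp [encodeGate]

lemma encodeCircuit_injective {U : QuantumOracle} {k n r a : ℕ} :
    Function.Injective (encodeCircuit : List (Gate U (Wire k n r a)) → List Token) := by
  intro C C' h
  unfold encodeCircuit at h
  induction C generalizing C' with
  | nil =>
    rcases C' with _ | ⟨g, C'⟩
    · rfl
    · simp [encodeGate_ne_nil] at h
  | cons g C ih =>
    rcases C' with _ | ⟨g', C'⟩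
    · simp [encodeGate_ne_nil] at h
    · simp only [List.flatMap_cons] at h
      obtain ⟨rfl, h₁⟩ := isPrefixCode_encodeGate _ _ _ _ h
      rw [ih h₁]

/-- Descriptions do not mention the oracle, so they can be compared between verifiers relative to
different oracles. -/
lemma encodeCircuit_map_retarget {O : BoolOracle} (O' : BoolOracle) {k n r a : ℕ}
    (C : List (Gate (phaseOracle O) (Wire k n r a))) :
    encodeCircuit (C.map (Gate.retarget O')) = encodeCircuit C := by
  unfold encodeCircuit
  rw [List.flatMap_map]
  congr 1
  funext g
  cases g <;> rfl

end

end QOracle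

namespace QOracle

noncomputable section

open Polynomial Turing

/-! ### The circuit that computes a Fourier coefficient -/

/-- The ancilla qubits as the arguments of a query to the `n`-th oracle unitary. -/
def queryWires (k n r : ℕ) : Fin ((X + 1 : ℕ[X]).eval n) ↪ Wire k n r n where
  toFun i := .ancilla (Fin.cast (eval_X_add_one n) i)
  inj' i j h := by simpa using h

/-- A Hadamard gate on each ancilla qubit. -/
def hadamards (U : QuantumOracle) (k n r : ℕ) : List (Gate U (Wire k n r n)) :=
  (List.finRange (n + 1)).map fun i => .had (.ancilla i)

/-- The circuit that queries the phase oracle between two layers of Hadamard gates on the ancilla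
qubits `1, …, n` and then flips the output qubit if these ancilla qubits are all zero. The last
step uses a second query, and the Hadamard gates on the output qubit that precede and follow it. -/
def fourierCircuit (O : BoolOracle) (k n r : ℕ) : List (Gate (phaseOracle O) (Wire k n r n)) :=
  hadamards _ k n r ++ ([.had (.ancilla 0)] ++ ([.query false n (queryWires k n r)] ++
    (hadamards _ k n r ++ ([.query false n (queryWires k n r)] ++ [.had (.ancilla 0)]))))

/-- The description of the `i`-th ancilla qubit. -/
def ancillaCode (i : ℕ) : List Token := Token.ancilla :: encodeNat i

/-- The description of a layer of Hadamard gates. -/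
def hadamardsCode (n : ℕ) : List Token :=
  (List.range (n + 1)).flatMap fun i => Token.had :: ancillaCode i

/-- The description of a query on all ancilla qubits. -/
def queryCode (n : ℕ) : List Token :=
  Token.query :: (encodeNat n ++ (List.range (n + 1)).flatMap ancillaCode)

/-- The description of a Hadamard gate on the output qubit. -/
def outputHadCode : List Token := Token.had :: ancillaCode 0

/-- The description of `fourierCircuit`. -/
def fourierCode (n : ℕ) : List Token :=
  hadamardsCode n ++ (outputHadCode ++ (queryCode n ++ (hadamardsCode n ++
    (queryCode n ++ outputHadCode))))

lemma flatMap_range_eq {β : Type} (n : ℕ) (f : ℕ → List β) :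
    (List.range n).flatMap f = (List.finRange n).flatMap fun i : Fin n => f i := by
  rw [← List.map_coe_finRange_eq_range]
  exact List.flatMap_map ..

lemma encode_hadamards (U : QuantumOracle) (k n r : ℕ) :
    encodeCircuit (hadamards U k n r) = hadamardsCode n := by
  unfold encodeCircuit hadamards hadamardsCode
  rw [List.flatMap_map, flatMap_range_eq]
  rfl

lemma ofFn_comp_cast {β : Type} {m n : ℕ} (h : m = n) (f : Fin n → β) :
    (List.ofFn fun i : Fin m => f (Fin.cast h i)) = List.ofFn f := by
  subst h
  rfl

lemma encode_query (O : BoolOracle) (k n r : ℕ) :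
    encodeCircuit [(Gate.query false n (queryWires k n r) :
      Gate (phaseOracle O) (Wire k n r n))] = queryCode n := by
  have h : List.ofFn (queryWires k n r) = (List.finRange (n + 1)).map Wire.ancilla :=
    (ofFn_comp_cast (eval_X_add_one n) fun i => Wire.ancilla i).trans List.ofFn_eq_map
  have h' : (List.ofFn (queryWires k n r)).flatMap encodeWire =
      (List.range (n + 1)).flatMap ancillaCode := by
    rw [h, flatMap_range_eq, List.flatMap_map]
    rfl
  unfold queryCode
  rw [← h']
  simp [encodeCircuit, encodeGate]

lemma encode_fourierCircuit (O : BoolOracle) (k n r : ℕ) :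
    encodeCircuit (fourierCircuit O k n r) = fourierCode n := by
  have app : ∀ C C' : List (Gate (phaseOracle O) (Wire k n r n)),
      encodeCircuit (C ++ C') = encodeCircuit C ++ encodeCircuit C' := fun C C' =>
    List.flatMap_append
  have had : encodeCircuit [(Gate.had (.ancilla 0) : Gate (phaseOracle O) (Wire k n r n))] =
      outputHadCode := rfl
  rw [fourierCircuit, app, app, app, app, app, encode_hadamards, encode_query, had]
  rfl

lemma length_fourierCircuit (O : BoolOracle) (k n r : ℕ) :
    (fourierCircuit O k n r).length = 2 * n + 6 := by
  simp [fourierCircuit, hadamards]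
  ring

/-! ### A Turing machine that writes down the circuit -/

namespace Writer

/-- The stacks of the machine. -/
inductive Stack : Type
  | inp | aux | keep | out
  deriving DecidableEq

instance : Fintype Stack := ⟨{.inp, .aux, .keep, .out}, fun s => by cases s <;> simp⟩

/-- The symbols on the stacks. -/
abbrev Symbol : Stack → Type
  | .out => Token
  | _ => Bool

/-- The layers of the circuit, from the last to the first one. -/
inductive Phase : Type
  | query₂ | had₂ | query₁ | had₁
  deriving DecidableEq

instance : Fintype Phase := ⟨{.query₂, .had₂, .query₁, .had₁}, fun s => by cases s <;> simp⟩

/-- The labels of the program. -/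
inductive Label : Type
  | start
  | wire (p : Phase)
  | copy (p : Phase)
  | decr (p : Phase)
  | back (p : Phase)
  | close (p : Phase)
  | restore (p : Phase)
  | drain
  deriving DecidableEq, Fintype

/-- The layer consists of one query. -/
def Phase.isQuery : Phase → Bool
  | .query₂ => true
  | .query₁ => true
  | _ => false

/-- The statements of the program. -/
abbrev Stmt : Type := TM2.Stmt Symbol Label (Option Bool)

/-- Write a token. -/
def write (t : Token) (q : Stmt) : Stmt := .push .out (fun _ => t) q

/-- Put a unit on a counter. -/
def incr : (k : Stack) → Stmt → Stmt
  | .inp, q => .push .inp (fun _ => true) q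
  | .aux, q => .push .aux (fun _ => true) q
  | .keep, q => .push .keep (fun _ => true) q
  | .out, q => q

/-- Take a unit from a counter, and continue with the first statement if there is one. -/
def take : (k : Stack) → Stmt → Stmt → Stmt
  | .inp, q, r => .pop .inp (fun _ o => o) (.branch (fun v => v.isSome) q r)
  | .aux, q, r => .pop .aux (fun _ o => o) (.branch (fun v => v.isSome) q r)
  | .keep, q, r => .pop .keep (fun _ o => o) (.branch (fun v => v.isSome) q r)
  | .out, _, r => r

/-- Jump to a label. -/
def jump (l : Label) : Stmt := .goto fun _ => l

/-- Write the description of a Hadamard gate on the output qubit. -/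
def writeOutputHad (q : Stmt) : Stmt := write .sep (write .ancilla (write .had q))

/-- What happens after a layer has been written. -/
def next : Phase → Stmt
  | .query₂ => jump (.wire .had₂)
  | .had₂ => jump (.wire .query₁)
  | .query₁ => writeOutputHad (jump (.wire .had₁))
  | .had₁ => jump .drain

/-- The program. For each layer, `inp` counts down from `n` to `0`, and the description of a wire
is written for each value. The value is moved to `aux` and back while it is written, and `keep`
takes the difference to `n`. -/
def program : Label → Stmt
  | .start => writeOutputHad (jump (.wire .query₂))
  | .wire p => write .sep (jump (.copy p))
  | .copy p => take .inp (incr .aux (write .tick (jump (.copy p))))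
      (write .ancilla (if p.isQuery then jump (.decr p) else write .had (jump (.decr p))))
  | .decr p => take .aux (incr .keep (jump (.back p))) (jump (.close p))
  | .back p => take .aux (incr .inp (jump (.back p))) (jump (.wire p))
  | .close p => if p.isQuery then write .sep (jump (.restore p)) else jump (.restore p)
  | .restore p => take .keep
      (incr .inp (if p.isQuery then write .tick (jump (.restore p)) else jump (.restore p)))
      (if p.isQuery then write .query (next p) else next p)
  | .drain => take .inp (jump .drain) .halt

/-- The machine. -/
def machine : FinTM2 where
  K := Stack
  k₀ := .inp
  k₁ := .out
  Γ := Symbol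
  Λ := Label
  main := .start
  σ := Option Bool
  initialState := none
  Γk₀Fin := inferInstanceAs (Fintype Bool)
  m := program

/-! ### Simulation of the writing machine. -/

/-- The stacks with given counter values and output. -/
def contents (i a k : ℕ) (o : List Token) : (s : Stack) → List (Symbol s)
  | .inp => List.replicate i true
  | .aux => List.replicate a true
  | .keep => List.replicate k true
  | .out => o

lemma update_inp (i a k : ℕ) (o : List Token) (i' : ℕ) :
    Function.update (contents i a k o) .inp (List.replicate i' true) = contents i' a k o := by
  funext s; cases s <;> rfl

lemma update_aux (i a k : ℕ) (o : List Token) (a' : ℕ) :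
    Function.update (contents i a k o) .aux (List.replicate a' true) = contents i a' k o := by
  funext s; cases s <;> rfl

lemma update_keep (i a k : ℕ) (o : List Token) (k' : ℕ) :
    Function.update (contents i a k o) .keep (List.replicate k' true) = contents i a k' o := by
  funext s; cases s <;> rfl

lemma update_out (i a k : ℕ) (o o' : List Token) :
    Function.update (contents i a k o) .out o' = contents i a k o' := by
  funext s; cases s <;> rfl

@[simp] lemma stepAux_write (t : Token) (q : Stmt) (v : Option Bool) (i a k : ℕ)
    (o : List Token) : TM2.stepAux (write t q) v (contents i a k o) =
      TM2.stepAux q v (contents i a k (t :: o)) := by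
  rw [← update_out i a k o (t :: o)]; rfl

@[simp] lemma stepAux_incr_inp (q : Stmt) (v : Option Bool) (i a k : ℕ) (o : List Token) :
    TM2.stepAux (incr .inp q) v (contents i a k o) =
      TM2.stepAux q v (contents (i + 1) a k o) := by
  rw [← update_inp i a k o (i + 1)]; rfl

@[simp] lemma stepAux_incr_aux (q : Stmt) (v : Option Bool) (i a k : ℕ) (o : List Token) :
    TM2.stepAux (incr .aux q) v (contents i a k o) =
      TM2.stepAux q v (contents i (a + 1) k o) := by
  rw [← update_aux i a k o (a + 1)]; rfl

@[simp] lemma stepAux_incr_keep (q : Stmt) (v : Option Bool) (i a k : ℕ) (o : List Token) :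
    TM2.stepAux (incr .keep q) v (contents i a k o) =
      TM2.stepAux q v (contents i a (k + 1) o) := by
  rw [← update_keep i a k o (k + 1)]; rfl

@[simp] lemma stepAux_take_inp_zero (q r : Stmt) (v : Option Bool) (a k : ℕ) (o : List Token) :
    TM2.stepAux (take .inp q r) v (contents 0 a k o) =
      TM2.stepAux r none (contents 0 a k o) := by
  conv_rhs => rw [← update_inp 0 a k o 0]
  rfl

@[simp] lemma stepAux_take_aux_zero (q r : Stmt) (v : Option Bool) (i k : ℕ) (o : List Token) :
    TM2.stepAux (take .aux q r) v (contents i 0 k o) =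
      TM2.stepAux r none (contents i 0 k o) := by
  conv_rhs => rw [← update_aux i 0 k o 0]
  rfl

@[simp] lemma stepAux_take_keep_zero (q r : Stmt) (v : Option Bool) (i a : ℕ) (o : List Token) :
    TM2.stepAux (take .keep q r) v (contents i a 0 o) =
      TM2.stepAux r none (contents i a 0 o) := by
  conv_rhs => rw [← update_keep i a 0 o 0]
  rfl

@[simp] lemma stepAux_take_inp_succ (q r : Stmt) (v : Option Bool) (i a k : ℕ)
    (o : List Token) : TM2.stepAux (take .inp q r) v (contents (i + 1) a k o) =
      TM2.stepAux q (some true) (contents i a k o) := by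
  rw [← update_inp (i + 1) a k o i]; rfl

@[simp] lemma stepAux_take_aux_succ (q r : Stmt) (v : Option Bool) (i a k : ℕ)
    (o : List Token) : TM2.stepAux (take .aux q r) v (contents i (a + 1) k o) =
      TM2.stepAux q (some true) (contents i a k o) := by
  rw [← update_aux i (a + 1) k o a]; rfl

@[simp] lemma stepAux_take_keep_succ (q r : Stmt) (v : Option Bool) (i a k : ℕ)
    (o : List Token) : TM2.stepAux (take .keep q r) v (contents i a (k + 1) o) =
      TM2.stepAux q (some true) (contents i a k o) := by
  rw [← update_keep i a (k + 1) o k]; rfl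

/-- The machine goes from one configuration to another one in `m` steps. -/
def Run (m : ℕ) (C D : TM2.Cfg Symbol Label (Option Bool)) : Prop :=
  (flip bind (TM2.step program))^[m] (some C) = some D

lemma Run.trans {m m' : ℕ} {C D E : TM2.Cfg Symbol Label (Option Bool)} (h : Run m C D)
    (h' : Run m' D E) : Run (m' + m) C E := by
  unfold Run at *
  rw [Function.iterate_add_apply, h, h']

lemma run_one (l : Label) (v : Option Bool) (i a k : ℕ) (o : List Token) :
    Run 1 ⟨some l, v, contents i a k o⟩ (TM2.stepAux (program l) v (contents i a k o)) := rfl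

/-- The tokens that precede the number of a wire. -/
def wirePrefix (p : Phase) : List Token :=
  if p.isQuery then [Token.ancilla] else [Token.had, Token.ancilla]

lemma replicate_succ_append_cons {β : Type} (n : ℕ) (b : β) (l : List β) :
    List.replicate (n + 1) b ++ l = List.replicate n b ++ b :: l := by
  rw [List.replicate_succ', List.append_assoc]
  rfl

lemma run_copy (p : Phase) (v : Option Bool) (i a k : ℕ) (o : List Token) :
    Run (i + 1) ⟨some (.copy p), v, contents i a k o⟩
      ⟨some (.decr p), none, contents 0 (i + a) k (wirePrefix p ++ (List.replicate i .tick ++ o))⟩ := by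
  induction i generalizing v a o with
  | zero =>
    have h := run_one (.copy p) v 0 a k o
    cases p <;> simpa [program, jump, wirePrefix, Phase.isQuery] using h
  | succ i ih =>
    have h := run_one (.copy p) v (i + 1) a k o
    simp only [program, stepAux_take_inp_succ, stepAux_incr_aux, stepAux_write, jump,
      TM2.stepAux] at h
    have h' := h.trans (ih (some true) (a + 1) (.tick :: o))
    rw [replicate_succ_append_cons, show i + 1 + a = i + (a + 1) by ring]
    exact h'

lemma run_back (p : Phase) (v : Option Bool) (i a k : ℕ) (o : List Token) :
    Run (a + 1) ⟨some (.back p), v, contents i a k o⟩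
      ⟨some (.wire p), none, contents (i + a) 0 k o⟩ := by
  induction a generalizing v i with
  | zero => simpa [program, jump] using run_one (.back p) v i 0 k o
  | succ a ih =>
    have h := run_one (.back p) v i (a + 1) k o
    simp only [program, stepAux_take_aux_succ, stepAux_incr_inp, jump, TM2.stepAux] at h
    rw [show i + (a + 1) = i + 1 + a by ring]
    exact h.trans (ih (some true) (i + 1))

/-- The output of the loop over the wires with numbers at most `i`. -/
def wiresCode (p : Phase) (i : ℕ) : List Token :=
  (List.range (i + 1)).flatMap fun j => wirePrefix p ++ encodeNat j

lemma run_wire_decr (p : Phase) (v : Option Bool) (i k : ℕ) (o : List Token) :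
    Run (i + 2) ⟨some (.wire p), v, contents i 0 k o⟩
      ⟨some (.decr p), none, contents 0 i k (wirePrefix p ++ encodeNat i ++ o)⟩ := by
  have h := run_one (.wire p) v i 0 k o
  simp only [program, stepAux_write, jump, TM2.stepAux] at h
  have h' := h.trans (run_copy p v i 0 k (.sep :: o))
  simpa [encodeNat] using h'

/-- Wire `j` costs `2 j + 3` steps, and these add up to `(i + 1) * (i + 3)`. The loop counts down
because tokens pushed later are read earlier. -/
lemma run_wires (p : Phase) (v : Option Bool) (i k : ℕ) (o : List Token) :
    Run ((i + 1) * (i + 3)) ⟨some (.wire p), v, contents i 0 k o⟩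
      ⟨some (.close p), none, contents 0 0 (k + i) (wiresCode p i ++ o)⟩ := by
  induction i generalizing v k o with
  | zero =>
    have h := run_one (.decr p) none 0 0 k (wirePrefix p ++ encodeNat 0 ++ o)
    simp only [program, stepAux_take_aux_zero, jump, TM2.stepAux] at h
    simpa [wiresCode] using (run_wire_decr p v 0 k o).trans h
  | succ i ih =>
    have h := run_one (.decr p) none 0 (i + 1) k (wirePrefix p ++ encodeNat (i + 1) ++ o)
    simp only [program, stepAux_take_aux_succ, stepAux_incr_keep, jump, TM2.stepAux] at h
    have h' := ((run_wire_decr p v (i + 1) k o).trans h).trans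
      ((run_back p _ 0 i (k + 1) _).trans (by rw [zero_add]; exact ih none (k + 1) _))
    have e : wiresCode p (i + 1) ++ o =
        wiresCode p i ++ (wirePrefix p ++ encodeNat (i + 1) ++ o) := by
      unfold wiresCode
      rw [List.range_succ (n := i + 1), List.flatMap_append]
      simp
    rw [e, show k + (i + 1) = k + 1 + i by ring,
      show (i + 1 + 1) * (i + 1 + 3) = (i + 1) * (i + 3) + (i + 1) + (1 + (i + 1 + 2)) by ring]
    exact h'

/-- The ticks written while the counter is restored form the unary index of the query. -/
lemma run_restore_query {p : Phase} (hp : p.isQuery = true) (v : Option Bool) (i k : ℕ)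
    (o : List Token) :
    Run (k + 1) ⟨some (.restore p), v, contents i 0 k o⟩
      (TM2.stepAux (next p) none
        (contents (i + k) 0 0 (.query :: (List.replicate k .tick ++ o)))) := by
  induction k generalizing v i o with
  | zero => simpa [program, hp] using run_one (.restore p) v i 0 0 o
  | succ k ih =>
    have h := run_one (.restore p) v i 0 (k + 1) o
    simp only [program, stepAux_take_keep_succ, stepAux_incr_inp, hp, if_true, stepAux_write, jump,
      TM2.stepAux] at h
    rw [show i + (k + 1) = i + 1 + k by ring, replicate_succ_append_cons]
    exact h.trans (ih (some true) (i + 1) (.tick :: o))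

lemma run_restore_had {p : Phase} (hp : p.isQuery = false) (v : Option Bool) (i k : ℕ)
    (o : List Token) :
    Run (k + 1) ⟨some (.restore p), v, contents i 0 k o⟩
      (TM2.stepAux (next p) none (contents (i + k) 0 0 o)) := by
  induction k generalizing v i with
  | zero => simpa [program, hp] using run_one (.restore p) v i 0 0 o
  | succ k ih =>
    have h := run_one (.restore p) v i 0 (k + 1) o
    simp only [program, stepAux_take_keep_succ, stepAux_incr_inp, hp, Bool.false_eq_true, if_false,
      jump, TM2.stepAux] at h
    rw [show i + (k + 1) = i + 1 + k by ring]
    exact h.trans (ih (some true) (i + 1))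

/-- The number of steps in which a layer is written. -/
def phaseTime (n : ℕ) : ℕ := n + 1 + (1 + (n + 1) * (n + 3))

lemma run_query {p : Phase} (hp : p.isQuery = true) (v : Option Bool) (n : ℕ) (o : List Token) :
    Run (phaseTime n) ⟨some (.wire p), v, contents n 0 0 o⟩
      (TM2.stepAux (next p) none (contents n 0 0 (queryCode n ++ o))) := by
  have h := run_one (.close p) none 0 0 n (wiresCode p n ++ o)
  simp only [program, hp, if_true, stepAux_write, jump, TM2.stepAux] at h
  have h' := run_wires p v n 0 o
  rw [zero_add] at h'
  have h'' := (h'.trans h).trans (run_restore_query hp none 0 n _)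
  rw [zero_add] at h''
  have e : queryCode n ++ o =
      .query :: (List.replicate n .tick ++ .sep :: (wiresCode p n ++ o)) := by
    simp [queryCode, wiresCode, encodeNat, wirePrefix, hp]
    rfl
  rw [e]
  exact h''

lemma run_hadamards {p : Phase} (hp : p.isQuery = false) (v : Option Bool) (n : ℕ)
    (o : List Token) :
    Run (phaseTime n) ⟨some (.wire p), v, contents n 0 0 o⟩
      (TM2.stepAux (next p) none (contents n 0 0 (hadamardsCode n ++ o))) := by
  have h := run_one (.close p) none 0 0 n (wiresCode p n ++ o)
  simp only [program, hp, Bool.false_eq_true, if_false, jump, TM2.stepAux] at h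
  have h' := run_wires p v n 0 o
  rw [zero_add] at h'
  have h'' := (h'.trans h).trans (run_restore_had hp none 0 n _)
  rw [zero_add] at h''
  have e : hadamardsCode n = wiresCode p n := by
    simp [hadamardsCode, wiresCode, encodeNat, wirePrefix, hp, ancillaCode]
  rw [e]
  exact h''

/-- The halting configuration `haltList` demands that every stack except the output be empty. -/
lemma run_drain (v : Option Bool) (i : ℕ) (o : List Token) :
    Run (i + 1) ⟨some .drain, v, contents i 0 0 o⟩ ⟨none, none, contents 0 0 0 o⟩ := by
  induction i generalizing v with
  | zero => simpa [program] using run_one .drain v 0 0 0 o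
  | succ i ih =>
    have h := run_one .drain v (i + 1) 0 0 o
    simp only [program, stepAux_take_inp_succ, jump, TM2.stepAux] at h
    exact h.trans (ih (some true))

/-- The output stack is read from its top, so the layers are written from the last to the first. -/
lemma run_machine (n : ℕ) :
    Run (n + 1 + (phaseTime n + (phaseTime n + (phaseTime n + (phaseTime n + 1)))))
      ⟨some .start, none, contents n 0 0 []⟩ ⟨none, none, contents 0 0 0 (fourierCode n)⟩ := by
  have h0 := run_one .start none n 0 0 []
  simp only [program, writeOutputHad, stepAux_write, jump, TM2.stepAux] at h0
  have h1 := h0.trans (run_query (p := .query₂) rfl none n _)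
  simp only [next, jump, TM2.stepAux] at h1
  have h2 := h1.trans (run_hadamards (p := .had₂) rfl none n _)
  simp only [next, jump, TM2.stepAux] at h2
  have h3 := h2.trans (run_query (p := .query₁) rfl none n _)
  simp only [next, writeOutputHad, stepAux_write, jump, TM2.stepAux] at h3
  have h4 := h3.trans (run_hadamards (p := .had₁) rfl none n _)
  simp only [next, jump, TM2.stepAux] at h4
  exact h4.trans (run_drain none n _)

lemma unaryEncodeNat_eq (n : ℕ) : Computability.unaryEncodeNat n = List.replicate n true := by
  induction n with
  | zero => rfl
  | succ n ih => rw [Computability.unaryEncodeNat, ih, List.replicate_succ]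

/-- The machine writes down the circuit in polynomial time. -/
def computable : TM2ComputableInPolyTime Computability.unaryEncodeNat id fourierCode where
  tm := machine
  inputAlphabet := Equiv.refl Bool
  outputAlphabet := Equiv.refl Token
  time := X + 1 + 4 * (X + 1 + (1 + (X + 1) * (X + 3))) + 1
  outputsFun n :=
    { steps := n + 1 + (phaseTime n + (phaseTime n + (phaseTime n + (phaseTime n + 1))))
      evals_in_steps := by
        have h := run_machine n
        unfold Run at h
        refine Eq.trans ?_ (h.trans ?_)
        · refine congrArg _ (congrArg some ?_)
          simp only [initList, machine, unaryEncodeNat_eq]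
          congr 1
          funext s
          cases s <;> simp [contents]
          rfl
        · refine congrArg some ?_
          simp only [haltList, machine]
          congr 1
          funext s
          cases s <;> simp [contents]
          rfl
      steps_le_m := by
        simp only [unaryEncodeNat_eq, List.length_replicate, phaseTime, eval_add, eval_mul, eval_X,
          eval_one, eval_ofNat]
        ring_nf
        rfl }

end Writer

end

end QOracle

namespace QOracle

noncomputable section

open Polynomial

/-! ### The acceptance probability of the circuit -/

/-- The number `1 / √2`. -/
def invSqrtTwo : ℂ := 1 / (Real.sqrt 2 : ℂ)

lemma sqrtTwo_mul_self : (Real.sqrt 2 : ℂ) * (Real.sqrt 2 : ℂ) = 2 := by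
  rw [← Complex.ofReal_mul, Real.mul_self_sqrt (by norm_num)]
  norm_num

lemma two_mul_invSqrtTwo_sq : 2 * (invSqrtTwo * invSqrtTwo) = 1 := by
  have h := sqrtTwo_mul_self
  have h0 : (Real.sqrt 2 : ℂ) ≠ 0 := fun e => by simp [e] at h
  unfold invSqrtTwo
  field_simp
  rw [sq, h]

section Hadamard

variable {W : Type} [DecidableEq W] {U : QuantumOracle}

lemma apply_had (w : W) (ψ : Amplitudes W) (x : W → Bool) :
    (Gate.had (U := U) w).apply ψ x = invSqrtTwo *
      (ψ (Function.update x w false) + sgn (x w) * ψ (Function.update x w true)) := by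
  simp only [Gate.apply, invSqrtTwo, sgn]
  ring

@[simp] lemma runCircuit_nil (ψ : Amplitudes W) :
    runCircuit ([] : List (Gate U W)) ψ = ψ := rfl

@[simp] lemma runCircuit_cons (g : Gate U W) (C : List (Gate U W)) (ψ : Amplitudes W) :
    runCircuit (g :: C) ψ = runCircuit C (g.apply ψ) := rfl

lemma runCircuit_append (C D : List (Gate U W)) (ψ : Amplitudes W) :
    runCircuit (C ++ D) ψ = runCircuit D (runCircuit C ψ) :=
  List.foldl_append ..

/-- Hadamard gates on the wires `e 0, …, e (m - 1)`. -/
def hadamardsOn (U : QuantumOracle) {m : ℕ} (e : Fin m → W) : List (Gate U W) :=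
  (List.finRange m).map fun i => .had (e i)

omit [DecidableEq W] in
lemma hadamardsOn_succ {m : ℕ} (e : Fin (m + 1) → W) :
    hadamardsOn U e = .had (e 0) :: hadamardsOn U (fun i => e i.succ) := by
  unfold hadamardsOn
  rw [List.finRange_succ, List.map_cons, List.map_map]
  rfl

/-- Hadamard gates on wires that are in the state zero. -/
lemma run_hadamardsOn_zero {m : ℕ} (e : Fin m → W) (he : Function.Injective e)
    (ψ χ : Amplitudes W) (hχ : ∀ x i b, χ (Function.update x (e i) b) = χ x)
    (hψ : ∀ x, ψ x = if ∀ i, x (e i) = false then χ x else 0) :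
    runCircuit (hadamardsOn U e) ψ = fun x => invSqrtTwo ^ m * χ x := by
  induction m generalizing ψ χ with
  | zero =>
    funext x
    simp [hadamardsOn, hψ]
  | succ m ih =>
    rw [hadamardsOn_succ, runCircuit_cons,
      ih (fun i => e i.succ) (fun i j h => Fin.succ_injective _ (he h)) _
        (fun x => invSqrtTwo * χ x) (fun x i b => by rw [hχ])]
    · funext x
      ring
    · intro x
      have hne : ∀ i : Fin m, e i.succ ≠ e 0 := fun i h => Fin.succ_ne_zero i (he h)
      rw [apply_had, hψ, hψ, hχ, hχ]
      simp [Fin.forall_fin_succ, Function.update_of_ne (hne _)]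

/-- Hadamard gates, evaluated at a basis state that is zero on their wires. -/
lemma run_hadamardsOn_apply_zero {m : ℕ} (e : Fin m → W) (he : Function.Injective e)
    (ψ : Amplitudes W) (x : W → Bool) (hx : ∀ i, x (e i) = false) :
    runCircuit (hadamardsOn U e) ψ x =
      invSqrtTwo ^ m * ∑ y : Fin m → Bool, ψ (Function.extend e y x) := by
  induction m generalizing ψ with
  | zero =>
    have : ∀ y : Fin 0 → Bool, Function.extend e y x = x := by
      intro y
      funext w
      exact Function.extend_apply' _ _ _ fun ⟨i, _⟩ => i.elim0
    simp [hadamardsOn, this]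
  | succ m ih =>
    have he' : Function.Injective fun i : Fin m => e i.succ :=
      fun i j h => Fin.succ_injective _ (he h)
    have hne : ∀ i : Fin m, e i.succ ≠ e 0 := fun i h => Fin.succ_ne_zero i (he h)
    have hcons : ∀ (b : Bool) (y : Fin m → Bool),
        Function.update (Function.extend (fun i => e i.succ) y x) (e 0) b =
          Function.extend e (Fin.cons b y : Fin (m + 1) → Bool) x := by
      intro b y
      funext w
      by_cases hw : ∃ i, e i = w
      · obtain ⟨i, rfl⟩ := hw
        rw [he.extend_apply]
        refine Fin.cases ?_ (fun i => ?_) i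
        · simp
        · rw [Function.update_of_ne (hne i), he'.extend_apply, Fin.cons_succ]
      · have hw' : ¬ ∃ i : Fin m, e i.succ = w := fun ⟨i, h⟩ => hw ⟨_, h⟩
        rw [Function.extend_apply' _ _ _ hw, Function.update_of_ne fun h => hw ⟨0, h.symm⟩,
          Function.extend_apply' _ _ _ hw']
    have hz : ∀ y : Fin m → Bool, Function.extend (fun i => e i.succ) y x (e 0) = false := by
      intro y
      rw [Function.extend_apply' _ _ _ fun ⟨i, h⟩ => hne i h, hx]
    rw [hadamardsOn_succ, runCircuit_cons, ih _ he' _ fun i => hx _,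
      ← (Fin.consEquiv fun _ => Bool).sum_comp, Fintype.sum_prod_type, Finset.sum_comm,
      pow_succ, mul_assoc, Finset.mul_sum Finset.univ _ invSqrtTwo]
    congr 1
    refine Finset.sum_congr rfl fun y _ => ?_
    rw [apply_had, hz, hcons, hcons, Fintype.sum_bool, show sgn false = 1 from rfl, one_mul,
      add_comm]
    rfl

/-- A wire outside of the Hadamard gates remains independent of the other wires. -/
lemma run_hadamardsOn_update {m : ℕ} (e : Fin m → W) (v : W) (hv : ∀ i, e i ≠ v)
    (ψ : Amplitudes W) (hψ : ∀ x b, ψ (Function.update x v b) = ψ x) (x : W → Bool) (b : Bool) :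
    runCircuit (hadamardsOn U e) ψ (Function.update x v b) =
      runCircuit (hadamardsOn U e) ψ x := by
  induction m generalizing ψ with
  | zero => exact hψ x b
  | succ m ih =>
    rw [hadamardsOn_succ, runCircuit_cons]
    refine ih _ (fun i => hv _) _ fun x b => ?_
    rw [apply_had, apply_had, Function.update_comm (hv 0).symm, Function.update_comm (hv 0).symm,
      hψ, hψ, Function.update_of_ne (hv 0)]

end Hadamard

/-- The sum `∑ (-1) ^ g y` over all `y`. -/
def signSum {n : ℕ} (g : (Fin n → Bool) → Bool) : ℤ := ∑ y, if g y then -1 else 1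

lemma cast_signSum {n : ℕ} (g : (Fin n → Bool) → Bool) :
    ((signSum g : ℤ) : ℂ) = ∑ y, sgn (g y) := by
  unfold signSum sgn
  push_cast
  rfl

/-- The probability that a circuit accepts the input `x` and the proofs `φ`. -/
def circuitAcceptProb {U : QuantumOracle} {k n r a : ℕ} (C : List (Gate U (Wire k n r a)))
    (x : Fin n → Bool) (φ : Fin k → Amplitudes (Fin r)) : ℝ :=
  ∑ z, if z (Wire.ancilla 0) then ‖runCircuit C (initialState x φ) z‖ ^ 2 else 0

section Fourier

variable {O : BoolOracle} {k n r : ℕ}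

lemma phaseBit_queryWires (g : (Fin n → Bool) → Bool) (z : Wire k n r n → Bool) :
    phaseBit g (fun i => z (queryWires k n r i)) =
      xor (g fun i => z (.ancilla i.succ))
        (z (.ancilla 0) && decide ((fun i : Fin n => z (.ancilla i.succ)) = fun _ => false)) := rfl

lemma apply_query_queryWires (ψ : Amplitudes (Wire k n r n)) (z : Wire k n r n → Bool) :
    (Gate.query (U := phaseOracle O) false n (queryWires k n r)).apply ψ z =
      sgn (phaseBit (O n) fun i => z (queryWires k n r i)) * ψ z :=
  apply_query O false n (queryWires k n r) ψ z

lemma ancilla_injective : Function.Injective (Wire.ancilla : Fin (n + 1) → Wire k n r n) :=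
  fun i j h => by simpa using h

/-- The basis state with input `x`, output bit one, and all other ancilla qubits zero. -/
def acceptingString (x : Fin n → Bool) : Wire 0 n r n → Bool
  | .input i => x i
  | .proof j _ => j.elim0
  | .ancilla i => decide (i = 0)

/-- The state before the first query. -/
lemma run_prepare (x : Fin n → Bool) (φ : Fin 0 → Amplitudes (Fin r)) :
    runCircuit (hadamards (phaseOracle O) 0 n r ++ [.had (.ancilla 0)]) (initialState x φ) =
      fun z => if (∀ i, z (.input i) = x i) ∧ z (.ancilla 0) = false then invSqrtTwo ^ n else 0 := by
  have h := run_hadamardsOn_zero (U := phaseOracle O)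
    (Wire.ancilla : Fin (n + 1) → Wire 0 n r n) ancilla_injective (initialState x φ)
    (fun z => if ∀ i, z (.input i) = x i then 1 else 0) (fun z i b => by simp) (fun z => by
      simp only [initialState, Finset.univ_eq_empty, Finset.prod_empty]
      by_cases h1 : ∀ i, z (.ancilla i) = false <;> simp [h1])
  rw [runCircuit_append, show hadamards (phaseOracle O) 0 n r = hadamardsOn _ Wire.ancilla from rfl,
    h, runCircuit_cons, runCircuit_nil]
  funext z
  rw [apply_had]
  have h2 := two_mul_invSqrtTwo_sq
  by_cases hx : ∀ i, z (.input i) = x i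
  · cases hz : z (.ancilla 0)
    · simp only [ne_eq, reduceCtorEq, not_false_eq_true, Function.update_of_ne, hx, implies_true,
        if_true, sgn, mul_one, and_self, Bool.false_eq_true, if_false]
      -- The single Hadamard gate cancels the one that the layer put on the output qubit: `2 (1/√2)
      -- ^ (n + 2) = (1/√2) ^ n`.
      linear_combination invSqrtTwo ^ n * h2
    · simp [hx, sgn]
  · simp [hx]

/-- The state before the second query. -/
lemma run_transform (O : BoolOracle) (x : Fin n → Bool) (φ : Fin 0 → Amplitudes (Fin r)) :
    ∃ ψ : Amplitudes (Wire 0 n r n),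
      runCircuit ((hadamards (phaseOracle O) 0 n r ++ [.had (.ancilla 0)]) ++
        ([.query false n (queryWires 0 n r)] ++ hadamards (phaseOracle O) 0 n r))
        (initialState x φ) = ψ ∧
      (∀ z b, ψ (Function.update z (.ancilla 0) b) = ψ z) ∧
      ∀ z, (∀ i : Fin n, z (.ancilla i.succ) = false) → ψ z =
        if ∀ i, z (.input i) = x i then
          invSqrtTwo ^ (n + 1) * invSqrtTwo ^ n * ∑ y, sgn (O n y) else 0 := by
  refine ⟨_, rfl, ?_⟩
  rw [runCircuit_append, run_prepare, runCircuit_append,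
    show hadamards (phaseOracle O) 0 n r = hadamardsOn _ Wire.ancilla from rfl, hadamardsOn_succ,
    runCircuit_cons, runCircuit_cons, runCircuit_nil]
  set χ : Amplitudes (Wire 0 n r n) := fun z => if (∀ i, z (.input i) = x i) then
    invSqrtTwo * (sgn (O n fun i => z (.ancilla i.succ)) * invSqrtTwo ^ n) else 0 with hχ
  -- The output qubit, which is the flag of the query, is zero here, so the query gives the bare
  -- sign of `O n`. The first gate of the next layer then makes the state independent of that qubit.
  have e : (Gate.had (U := phaseOracle O) (Wire.ancilla 0)).apply
      ((Gate.query (U := phaseOracle O) false n (queryWires 0 n r)).apply fun z =>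
        if (∀ i, z (.input i) = x i) ∧ z (.ancilla 0) = false then invSqrtTwo ^ n else 0) = χ := by
    funext z
    rw [apply_had, apply_query_queryWires, apply_query_queryWires, phaseBit_queryWires,
      phaseBit_queryWires, hχ]
    by_cases hx : ∀ i, z (.input i) = x i
    · simp [hx, Fin.succ_ne_zero]
    · simp [hx]
  rw [e]
  have hinj : Function.Injective fun i : Fin n => (Wire.ancilla i.succ : Wire 0 n r n) :=
    ancilla_injective.comp (Fin.succ_injective n)
  constructor
  · refine run_hadamardsOn_update _ _ (fun i h => Fin.succ_ne_zero i (ancilla_injective h)) _ ?_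
    intro z b
    simp [hχ, Fin.succ_ne_zero]
  · intro z hz
    rw [run_hadamardsOn_apply_zero _ hinj _ _ hz]
    have hext : ∀ y : Fin n → Bool,
        χ (Function.extend (fun i : Fin n => (Wire.ancilla i.succ : Wire 0 n r n)) y z) =
          if ∀ i, z (.input i) = x i then invSqrtTwo * (sgn (O n y) * invSqrtTwo ^ n) else 0 := by
      intro y
      have h1 : ∀ i, Function.extend (fun i : Fin n => (Wire.ancilla i.succ : Wire 0 n r n)) y z
          (.input i) = z (.input i) := fun i =>
        Function.extend_apply' _ _ _ fun ⟨j, h⟩ => by cases h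
      have h2 : ∀ i : Fin n, Function.extend
          (fun i : Fin n => (Wire.ancilla i.succ : Wire 0 n r n)) y z (.ancilla i.succ) = y i :=
        fun i => hinj.extend_apply _ _ _
      simp only [hχ, h1, h2]
    simp only [hext]
    split_ifs
    · rw [← Finset.mul_sum, ← Finset.sum_mul]
      ring
    · simp

/-- The circuit accepts with the square of the Fourier coefficient `2⁻ⁿ ∑ (-1) ^ O n y`. -/
theorem circuitAcceptProb_fourierCircuit (O : BoolOracle) (x : Fin n → Bool)
    (φ : Fin 0 → Amplitudes (Fin r)) :
    circuitAcceptProb (fourierCircuit O 0 n r) x φ = ((signSum (O n) : ℝ) / 2 ^ n) ^ 2 := by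
  obtain ⟨ψ, hrun, hindep, hzero⟩ := run_transform O x φ
  have hfin : runCircuit (fourierCircuit O 0 n r) (initialState x φ) =
      (Gate.had (U := phaseOracle O) (.ancilla 0)).apply
        ((Gate.query (U := phaseOracle O) false n (queryWires 0 n r)).apply ψ) := by
    rw [← hrun]
    simp only [fourierCircuit, runCircuit_append, runCircuit_cons, runCircuit_nil]
  -- Between the Hadamard gates on the flag, the second query acts as a phase kickback: the two
  -- branches cancel at output one unless the other ancilla qubits are all zero.
  have hval : ∀ z : Wire 0 n r n → Bool, z (.ancilla 0) = true →
      runCircuit (fourierCircuit O 0 n r) (initialState x φ) z = invSqrtTwo *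
        ((sgn (O n fun i => z (.ancilla i.succ)) -
          sgn (xor (O n fun i => z (.ancilla i.succ))
            (decide ((fun i : Fin n => z (.ancilla i.succ)) = fun _ => false)))) * ψ z) := by
    intro z hz
    rw [hfin, apply_had, apply_query_queryWires, apply_query_queryWires, phaseBit_queryWires,
      phaseBit_queryWires, hindep, hindep, hz]
    have hne : ∀ i : Fin n, (Wire.ancilla i.succ : Wire 0 n r n) ≠ .ancilla 0 := fun i h =>
      Fin.succ_ne_zero i (ancilla_injective h)
    simp only [Function.update_self, Function.update_of_ne (hne _), Bool.false_and,
      Bool.xor_false, Bool.true_and]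
    rw [show sgn true = -1 from rfl]
    ring
  unfold circuitAcceptProb
  rw [Finset.sum_eq_single (acceptingString x)]
  · have h0 : acceptingString (r := r) x (.ancilla 0) = true := by simp [acceptingString]
    have hs : ∀ i : Fin n, acceptingString (r := r) x (.ancilla i.succ) = false := fun i => by
      simp [acceptingString, Fin.succ_ne_zero]
    have hi : ∀ i, acceptingString (r := r) x (.input i) = x i := fun i => rfl
    rw [if_pos h0, hval _ h0, hzero _ hs]
    simp only [hs, hi, implies_true, if_true, decide_true, Bool.xor_true]
    rw [← cast_signSum]
    have hb : ∀ b : Bool, ‖sgn b - sgn (!b)‖ = 2 := fun b => by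
      cases b <;> simp [sgn] <;> norm_num
    have hc : ‖invSqrtTwo‖ ^ 2 = 1 / 2 := by
      have := congrArg (‖·‖) two_mul_invSqrtTwo_sq
      simp only [norm_mul, norm_one, Complex.norm_ofNat] at this
      nlinarith
    rw [norm_mul, norm_mul, hb, norm_mul, norm_mul, norm_pow, norm_pow, Complex.norm_intCast]
    -- The amplitude has `1 + (n + 1) + n` factors `1/√2`, and the two branches add up to modulus
    -- `2`.
    calc _ = 4 * (‖invSqrtTwo‖ ^ 2) ^ (2 * n + 2) * |(signSum (O n) : ℝ)| ^ 2 := by ring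
      _ = _ := by
        rw [hc, sq_abs, div_pow, pow_add, pow_mul]
        field_simp
        ring
  · intro z _ hz
    split_ifs with h0
    · rw [hval z h0]
      by_cases hs : (fun i : Fin n => z (.ancilla i.succ)) = fun _ => false
      · have hs' : ∀ i : Fin n, z (.ancilla i.succ) = false := fun i => congrFun hs i
        rw [hzero z hs', if_neg]
        · simp
        · intro hi
          apply hz
          funext w
          rcases w with i | ⟨j, _⟩ | i
          · exact hi i
          · exact j.elim0
          · refine Fin.cases ?_ (fun i => ?_) i
            · simp [h0, acceptingString]
            · simp [hs', acceptingString, Fin.succ_ne_zero]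
      · simp [hs]
    · rfl
  · simp

end Fourier

/-! ### The language -/

/-- The language of all strings whose length `n` is such that the `n`-th function does not take both
values equally often. -/
def imbalanceLanguage (O : BoolOracle) : Language Bool := {x | signSum (O x.length) ≠ 0}

/-- `X.eval n` equals `n` only propositionally, so the circuits of `fourierFamily` are transported
along this equation. -/
lemma circuitAcceptProb_cast {U : QuantumOracle} {k n r a : ℕ} (h : n = a)
    (C : List (Gate U (Wire k n r n))) (x : Fin n → Bool) (φ : Fin k → Amplitudes (Fin r)) :
    circuitAcceptProb (h ▸ C : List (Gate U (Wire k n r a))) x φ = circuitAcceptProb C x φ := by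
  subst h
  rfl

lemma encodeCircuit_cast {U : QuantumOracle} {k n r a : ℕ} (h : n = a)
    (C : List (Gate U (Wire k n r n))) :
    encodeCircuit (h ▸ C : List (Gate U (Wire k n r a))) = encodeCircuit C := by
  subst h
  rfl

lemma length_cast {U : QuantumOracle} {k n r a : ℕ} (h : n = a)
    (C : List (Gate U (Wire k n r n))) :
    (h ▸ C : List (Gate U (Wire k n r a))).length = C.length := by
  subst h
  rfl

/-- The circuits `fourierCircuit` as a uniform family. -/
def fourierFamily (O : BoolOracle) : UniformFamily (phaseOracle O) 0 where
  proofLen := 0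
  ancillas := X
  circuit n := (eval_X (x := n)).symm ▸ fourierCircuit O 0 n _
  size := 2 * X + 6
  size_le n := by
    rw [length_cast, length_fourierCircuit]
    simp
  uniform := by
    have : (fun n => encodeCircuit ((eval_X (x := n)).symm ▸ fourierCircuit O 0 n
        (eval n (0 : ℕ[X])) : List (Gate (phaseOracle O) (Wire 0 n (eval n 0) (eval n X))))) =
        fourierCode := by
      funext n
      rw [encodeCircuit_cast, encode_fourierCircuit]
    rw [this]
    exact ⟨Writer.computable⟩

/-- A nonzero integer has square at least one, which gives the threshold `2 ^ (-2n)`; a zero sum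
gives probability zero. -/
theorem imbalanceLanguage_mem_SBQP (O : BoolOracle) :
    imbalanceLanguage O ∈ SBQP (phaseOracle O) := by
  have hprob : ∀ x : List Bool, (fourierFamily O).acceptProb x Fin.elim0 =
      ((signSum (O x.length) : ℝ) / 2 ^ x.length) ^ 2 := fun x =>
    (circuitAcceptProb_cast _ _ _ _).trans (circuitAcceptProb_fourierCircuit O x.get _)
  refine ⟨fourierFamily O, 2 * X, fun x hx => ?_, fun x hx => ?_⟩
  · rw [hprob, div_pow (signSum (O x.length) : ℝ)]
    have h1 : (1 : ℝ) ≤ (signSum (O x.length) : ℝ) ^ 2 := by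
      have : (1 : ℤ) ≤ signSum (O x.length) ^ 2 := by
        have := sq_pos_of_ne_zero (show signSum (O x.length) ≠ 0 from hx)
        omega
      exact_mod_cast this
    calc (1 / 2 : ℝ) ^ (2 * X : ℕ[X]).eval x.length = 1 / (2 ^ x.length) ^ 2 := by
          rw [eval_mul, eval_X, eval_ofNat, pow_mul', div_pow, div_pow, one_pow, one_pow]
      _ ≤ _ := by gcongr
  · have h0 : signSum (O x.length) = 0 := not_not.1 hx
    rw [hprob, h0]
    simp

end

end QOracle

namespace QOracle

noncomputable section

open Polynomial Filter Turing

/-! ### Proofs for imbalanced functions also convince the verifier of a balanced one -/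

/-- On the support of the initial state a string is determined by its proof bits, and the sum over
these factors into the squared norms of the proofs. -/
lemma l2norm_initialState_le {k n r a : ℕ} (x : Fin n → Bool) (φ : Fin k → Amplitudes (Fin r))
    (hφ : ∀ j, IsState (φ j)) : l2norm (initialState (a := a) x φ) ≤ 1 := by
  rw [← abs_of_nonneg (l2norm_nonneg _), ← abs_one, ← sq_le_sq, l2norm_sq, one_pow]
  let proofs : (Wire k n r a → Bool) → Fin k → Fin r → Bool := fun z j i => z (.proof j i)
  let S : Finset (Wire k n r a → Bool) := Finset.univ.filter fun z =>
    (∀ i, z (.input i) = x i) ∧ ∀ i, z (.ancilla i) = false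
  have hinj : Set.InjOn proofs S := by
    intro z hz z' hz' h
    simp only [S, Finset.coe_filter, Finset.mem_univ, true_and, Set.mem_ofPred_eq] at hz hz'
    funext w
    rcases w with i | ⟨j, i⟩ | i
    · rw [hz.1, hz'.1]
    · exact congrFun (congrFun h j) i
    · rw [hz.2, hz'.2]
  calc ∑ z, ‖initialState (a := a) x φ z‖ ^ 2
      = ∑ z ∈ S, ∏ j, ‖φ j (proofs z j)‖ ^ 2 := by
        rw [Finset.sum_filter]
        refine Finset.sum_congr rfl fun z _ => ?_
        unfold initialState
        split_ifs
        · rw [norm_prod, Finset.prod_pow]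
        · simp
    _ = ∑ u ∈ S.image proofs, ∏ j, ‖φ j (u j)‖ ^ 2 :=
        (Finset.sum_image hinj (f := fun u => ∏ j, ‖φ j (u j)‖ ^ 2)).symm
    _ ≤ ∑ u : Fin k → Fin r → Bool, ∏ j, ‖φ j (u j)‖ ^ 2 :=
        Finset.sum_le_univ_sum_of_nonneg fun u => by positivity
    _ = ∏ j, ∑ u, ‖φ j u‖ ^ 2 := by
        rw [Finset.prod_univ_sum, Fintype.piFinset_univ]
    _ = 1 := Finset.prod_eq_one fun j _ => hφ j

/-- The part of `ψ` in which the output qubit is one. -/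
def acceptingPart {k n r a : ℕ} (ψ : Amplitudes (Wire k n r a)) : Amplitudes (Wire k n r a) :=
  fun z => if z (.ancilla 0) then ψ z else 0

lemma circuitAcceptProb_eq {U : QuantumOracle} {k n r a : ℕ} (C : List (Gate U (Wire k n r a)))
    (x : Fin n → Bool) (φ : Fin k → Amplitudes (Fin r)) :
    circuitAcceptProb C x φ = l2norm (acceptingPart (runCircuit C (initialState x φ))) ^ 2 := by
  rw [l2norm_sq, circuitAcceptProb]
  refine Finset.sum_congr rfl fun z _ => ?_
  unfold acceptingPart
  split_ifs <;> simp

lemma l2norm_acceptingPart_le {k n r a : ℕ} (ψ φ : Amplitudes (Wire k n r a)) :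
    l2norm (acceptingPart ψ) ≤ l2norm (acceptingPart φ) + l2norm (ψ - φ) := by
  refine (l2norm_le_add_sub _ (acceptingPart φ)).trans (add_le_add le_rfl (l2norm_mono fun z => ?_))
  simp only [acceptingPart, Pi.sub_apply]
  split_ifs <;> simp

/-- If a short circuit accepts some proof for the oracle `O`, then it also accepts this proof for
an oracle that differs in a single point of a given large set. -/
lemma exists_circuitAcceptProb_update {O₀ : BoolOracle} (O : BoolOracle) {k n r a m : ℕ} (b : Bool)
    (C : List (Gate (phaseOracle O₀) (Wire k n r a))) (x : Fin n → Bool)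
    (φ : Fin k → Amplitudes (Fin r)) (hφ : ∀ j, IsState (φ j)) (S : Finset (Fin m → Bool))
    (hne : S.Nonempty) (hS : 100 * C.length ^ 2 ≤ S.card)
    (h : 2 / 3 ≤ circuitAcceptProb (C.map (Gate.retarget O)) x φ) :
    ∃ y ∈ S, 1 / 3 < circuitAcceptProb
      (C.map (Gate.retarget (Function.update O m (Function.update (O m) y b)))) x φ := by
  obtain ⟨y, hy, hclose⟩ :=
    exists_l2norm_runWith_update_sub_le O b C (initialState x φ) S hne
  refine ⟨y, hy, ?_⟩
  set O' := Function.update O m (Function.update (O m) y b)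
  rw [circuitAcceptProb_eq] at h ⊢
  set ψ := runCircuit (C.map (Gate.retarget O)) (initialState x φ) with hψ
  set ψ' := runCircuit (C.map (Gate.retarget O')) (initialState x φ) with hψ'
  change l2norm (ψ - ψ') * √S.card ≤ _ at hclose
  have hpos : 0 < √(S.card : ℝ) := Real.sqrt_pos.2 (by exact_mod_cast hne.card_pos)
  -- The constant `100` becomes `10` here, so the final states are within `2 / 10 = 1/5`.
  have hsqrt : 10 * (C.length : ℝ) ≤ √S.card := by
    apply Real.le_sqrt_of_sq_le
    have : (100 * C.length ^ 2 : ℝ) ≤ S.card := by exact_mod_cast hS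
    linarith
  have hlen : (2 * C.length : ℝ) * l2norm (initialState (a := a) x φ) ≤ 2 * C.length :=
    mul_le_of_le_one_right (by positivity) (l2norm_initialState_le x φ hφ)
  have hd : l2norm (ψ - ψ') ≤ 1 / 5 := by
    refine le_of_mul_le_mul_right ?_ hpos
    linarith
  have htri := l2norm_acceptingPart_le ψ ψ'
  have hnonneg := l2norm_nonneg (acceptingPart ψ')
  by_contra hcon
  -- Since `√(1/3) < 0.58` and `0.81 < √(2/3)`, the accepting parts would differ in norm by at least
  -- `0.23`, more than `1/5`.
  have h1 : l2norm (acceptingPart ψ') ≤ 0.58 := by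
    apply le_of_sq_le_sq _ (by norm_num)
    linarith
  have h2 : 0.81 ≤ l2norm (acceptingPart ψ) := by
    apply le_of_sq_le_sq _ (l2norm_nonneg _)
    linarith
  linarith

lemma signSum_eq {n : ℕ} (S : Finset (Fin n → Bool)) :
    signSum (fun y => decide (y ∈ S)) = 2 ^ n - 2 * S.card := by
  have h : ∀ y : Fin n → Bool, (if decide (y ∈ S) = true then (-1 : ℤ) else 1) =
      1 - 2 * if y ∈ S then 1 else 0 := by
    intro y
    by_cases hy : y ∈ S <;> simp [hy]
  unfold signSum
  simp only [h]
  rw [Finset.sum_sub_distrib, ← Finset.mul_sum, Finset.sum_boole]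
  simp

/-- An imbalanced function that becomes balanced when a single value is changed in any of more than
half of the points. -/
lemma exists_imbalanced {n : ℕ} (hn : 1 ≤ n) :
    ∃ (g : (Fin n → Bool) → Bool) (S : Finset (Fin n → Bool)), 2 ^ (n - 1) ≤ S.card ∧
      signSum g ≠ 0 ∧ ∀ y ∈ S, signSum (Function.update g y false) = 0 := by
  obtain ⟨m, rfl⟩ : ∃ m, n = m + 1 := ⟨n - 1, by omega⟩
  have hcard : 2 ^ m + 1 ≤ (Finset.univ : Finset (Fin (m + 1) → Bool)).card := by
    have := Nat.one_le_two_pow (n := m)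
    rw [Finset.card_univ, Fintype.card_fun, Fintype.card_bool, Fintype.card_fin, pow_succ]
    omega
  -- One point more than half makes the sum of the indicator's signs `-2`, and erasing a point
  -- raises it by `2`.
  obtain ⟨S, -, hS⟩ := Finset.exists_subset_card_eq hcard
  refine ⟨fun y => decide (y ∈ S), S, by simp [hS], ?_, fun y hy => ?_⟩
  · rw [signSum_eq, hS, pow_succ]
    push_cast
    omega
  · have : Function.update (fun y => decide (y ∈ S)) y false =
        fun z => decide (z ∈ S.erase y) := by
      funext z
      rcases eq_or_ne z y with rfl | hz
      · simp
      · simp [hz]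
    rw [this, signSum_eq, Finset.card_erase_of_mem hy, hS, pow_succ]
    push_cast [Nat.add_sub_cancel]
    ring

lemma eventually_mul_eval_sq_le (s : ℕ[X]) :
    ∀ᶠ n : ℕ in atTop, 100 * s.eval n ^ 2 ≤ 2 ^ (n - 1) := by
  -- The constant `200` absorbs the factor two between `2 ^ n` and `2 ^ (n - 1)`.
  set P : ℝ[X] := (C 200 * s ^ 2).map (Nat.castRingHom ℝ) with hP
  have h1 : (fun x : ℝ => P.eval x) =O[atTop] fun x : ℝ => (X ^ P.natDegree : ℝ[X]).eval x :=
    Polynomial.isBigO_atTop_of_degree_le P _ (by simp)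
  have hpow : ((fun x : ℝ => (X ^ P.natDegree : ℝ[X]).eval x) ∘ fun n : ℕ => (n : ℝ))
      =o[atTop] fun n : ℕ => (2 : ℝ) ^ n := by
    simpa [Function.comp_def] using
      isLittleO_pow_const_const_pow_of_one_lt (R := ℝ) P.natDegree one_lt_two
  have h2 := (h1.comp_tendsto (tendsto_natCast_atTop_atTop (R := ℝ))).trans_isLittleO hpow
  filter_upwards [h2.bound one_pos, eventually_ge_atTop 1] with n hn hn1
  have hev : P.eval (n : ℝ) = ((200 * s.eval n ^ 2 : ℕ) : ℝ) := by
    rw [hP, eval_natCast_map]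
    simp
  simp only [Function.comp_apply] at hn
  rw [hev, one_mul, Real.norm_of_nonneg (by positivity), Real.norm_of_nonneg (by positivity)] at hn
  have hn' : 200 * s.eval n ^ 2 ≤ 2 ^ n := by exact_mod_cast hn
  obtain ⟨m, rfl⟩ : ∃ m, n = m + 1 := ⟨n - 1, by omega⟩
  rw [pow_succ 2] at hn'
  simp only [add_tsub_cancel_right]
  omega

/-! ### Diagonalization -/

/-- The lengths of the proofs, the numbers of ancilla qubits and the descriptions of the circuits of
a verifier. -/
abbrev VerifierData : Type := ℕ[X] × ℕ[X] × (ℕ → List Token)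

/-- A verifier with two proofs decides a language with bounded error. -/
def Decides {U : QuantumOracle} (V : UniformFamily U 2) (L : Language Bool) : Prop :=
  (∀ x ∈ L, ∃ φ, (∀ j, IsState (φ j)) ∧ 2 / 3 ≤ V.acceptProb x φ) ∧
    (∀ x ∉ L, ∀ φ, (∀ j, IsState (φ j)) → V.acceptProb x φ ≤ 1 / 3)

/-- The oracles relative to which no verifier with the given data decides the language. -/
def fooled (d : VerifierData) : Set BoolOracle :=
  {O | ∀ V : UniformFamily (phaseOracle O) 2, V.proofLen = d.1 → V.ancillas = d.2.1 →
    (fun n => encodeCircuit (V.circuit n)) = d.2.2 → ¬ Decides V (imbalanceLanguage O)}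

/-- Oracles that agree with a given one in finitely many functions form an open set. -/
lemma isOpen_agree (O : BoolOracle) (M : ℕ) : IsOpen {O' : BoolOracle | ∀ m < M, O' m = O m} := by
  have : {O' : BoolOracle | ∀ m < M, O' m = O m} =
      ⋂ m ∈ Finset.range M, (fun O' : BoolOracle => O' m) ⁻¹' {O m} := by
    ext
    simp
  rw [this]
  exact isOpen_biInter_finset fun m _ => (isOpen_discrete _).preimage (continuous_apply m)

/-- One wrongly treated input suffices: any verifier relative to `O` with these data runs the
retargeted circuit, because the description determines it. -/
lemma mem_fooled {O₀ O : BoolOracle} {pl an : ℕ[X]}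
    {circ : (n : ℕ) → List (Gate (phaseOracle O₀) (Wire 2 n (pl.eval n) (an.eval n)))}
    (x : List Bool)
    (h : (x ∈ imbalanceLanguage O ∧ ¬ ∃ φ, (∀ j, IsState (φ j)) ∧
        2 / 3 ≤ circuitAcceptProb ((circ x.length).map (Gate.retarget O)) x.get φ) ∨
      (x ∉ imbalanceLanguage O ∧ ∃ φ, (∀ j, IsState (φ j)) ∧
        1 / 3 < circuitAcceptProb ((circ x.length).map (Gate.retarget O)) x.get φ)) :
    O ∈ fooled ⟨pl, an, fun n => encodeCircuit (circ n)⟩ := by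
  rintro ⟨pl', an', circ', _, _, _⟩ hpl han hcode ⟨hyes, hno⟩
  dsimp only at hpl han
  subst hpl han
  have hcirc : circ' x.length = (circ x.length).map (Gate.retarget O) := by
    apply encodeCircuit_injective
    rw [encodeCircuit_map_retarget]
    exact congrFun hcode x.length
  rw [← hcirc] at h
  rcases h with ⟨hx, hφ⟩ | ⟨hx, φ, hφ, hlt⟩
  · exact hφ (hyes x hx)
  · exact absurd (hno x hx φ hφ) (not_le.2 hlt)

lemma dense_interior_fooled (d : VerifierData) : Dense (interior (fooled d)) := by
  by_cases hd : ∃ (O₀ : BoolOracle) (V : UniformFamily (phaseOracle O₀) 2),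
    V.proofLen = d.1 ∧ V.ancillas = d.2.1 ∧ (fun n => encodeCircuit (V.circuit n)) = d.2.2
  swap
  · have : fooled d = Set.univ := Set.eq_univ_of_forall fun O V h1 h2 h3 =>
      absurd ⟨O, V, h1, h2, h3⟩ hd
    rw [this, interior_univ]
    exact dense_univ
  obtain ⟨O₀, ⟨pl, an, circ, size, size_le, _⟩, h1, h2, h3⟩ := hd
  obtain ⟨pl', an', code⟩ := d
  dsimp only at h1 h2 h3
  subst h1 h2 h3
  rw [dense_iff_inter_open]
  rintro N hN ⟨O, hO⟩
  -- A basic neighbourhood constrains only the functions with indices in `I`; a length beyond `I`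
  -- leaves `O n` free to be redefined.
  obtain ⟨I, u, hu, hIN⟩ := isOpen_pi_iff.1 hN O hO
  obtain ⟨n, hn, hn1, hnI⟩ := ((eventually_mul_eval_sq_le size).and
    ((eventually_ge_atTop 1).and (eventually_gt_atTop (I.sup id)))).exists
  obtain ⟨x, rfl⟩ : ∃ x : List Bool, x.length = n := ⟨List.replicate n true, by simp⟩
  obtain ⟨g, S, hS, hg, hflip⟩ := exists_imbalanced hn1
  obtain ⟨M, hM⟩ := exists_runWith_eq (circ x.length)
  have hmem : ∀ f, Function.update O x.length f ∈ N := fun f => hIN fun i hi => by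
    have : i ≠ x.length := fun e => by
      have := Finset.le_sup (f := id) hi
      simp only [id] at this
      omega
    rw [Function.update_of_ne this]
    exact (hu i hi).2
  -- Agreement below `M` fixes the circuit's behaviour, and agreement below `x.length + 1` fixes
  -- whether `x` is in the language; together they make failure at `x` an open condition.
  have hprob : ∀ O₁ O₂ : BoolOracle, (∀ m < max M (x.length + 1), O₂ m = O₁ m) → ∀ φ,
      circuitAcceptProb ((circ x.length).map (Gate.retarget O₂)) x.get φ =
        circuitAcceptProb ((circ x.length).map (Gate.retarget O₁)) x.get φ := by
    intro O₁ O₂ h φ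
    have := hM O₂ O₁ fun m hm => h m (lt_max_of_lt_left hm)
    rw [circuitAcceptProb_eq, circuitAcceptProb_eq]
    exact congrArg (fun ψ => l2norm (acceptingPart ψ) ^ 2) (congrFun this _)
  have hint : ∀ O₁ : BoolOracle, (∀ O₂ : BoolOracle, (∀ m < max M (x.length + 1), O₂ m = O₁ m) →
      O₂ ∈ fooled ⟨pl, an, fun n => encodeCircuit (circ n)⟩) →
      O₁ ∈ interior (fooled ⟨pl, an, fun n => encodeCircuit (circ n)⟩) := fun O₁ h =>
    mem_interior.2 ⟨_, h, isOpen_agree O₁ _, fun m _ => rfl⟩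
  have hlang : ∀ O₁ O₂ : BoolOracle, (∀ m < max M (x.length + 1), O₂ m = O₁ m) →
      (x ∈ imbalanceLanguage O₂ ↔ signSum (O₁ x.length) ≠ 0) := fun O₁ O₂ h => by
    rw [← h x.length (lt_max_of_lt_right x.length.lt_succ_self)]
    rfl
  set O₁ := Function.update O x.length g with hO₁
  have hO₁n : O₁ x.length = g := Function.update_self ..
  -- Either no proof convinces the verifier for the imbalanced function, which breaks completeness,
  -- or some proof does, and a single change of the function breaks soundness.
  by_cases hacc : ∃ φ, (∀ j, IsState (φ j)) ∧
    2 / 3 ≤ circuitAcceptProb ((circ x.length).map (Gate.retarget O₁)) x.get φ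
  · obtain ⟨φ, hφ, hle⟩ := hacc
    have hlen : 100 * (circ x.length).length ^ 2 ≤ S.card :=
      (Nat.mul_le_mul_left _ (Nat.pow_le_pow_left (size_le _) 2)).trans (hn.trans hS)
    have hne : S.Nonempty := Finset.card_pos.1 (lt_of_lt_of_le (by positivity) hS)
    obtain ⟨y, hy, hlt⟩ :=
      exists_circuitAcceptProb_update O₁ false (circ x.length) x.get φ hφ S hne hlen hle
    rw [hO₁n] at hlt
    refine ⟨Function.update O₁ x.length (Function.update g y false), ?_, hint _ fun O₂ h => ?_⟩
    · rw [hO₁, Function.update_idem]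
      exact hmem _
    · refine mem_fooled x (Or.inr ⟨?_, φ, hφ, ?_⟩)
      · rw [hlang _ _ h, Function.update_self]
        exact not_not.2 (hflip y hy)
      · rw [hprob _ _ h]
        exact hlt
  · refine ⟨O₁, hmem g, hint _ fun O₂ h => mem_fooled x (Or.inl ⟨?_, ?_⟩)⟩
    · rw [hlang _ _ h, hO₁n]
      exact hg
    · simpa only [hprob _ _ h] using hacc

/-- There is an oracle relative to which no verifier with two proofs decides the language. -/
theorem exists_imbalanceLanguage_notMem_QMA :
    ∃ O : BoolOracle, imbalanceLanguage O ∉ QMA 2 (phaseOracle O) := by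
  let D : Set VerifierData := Set.univ ×ˢ Set.univ ×ˢ
    {f | Nonempty (TM2ComputableInPolyTime Computability.unaryEncodeNat id f)}
  have : Countable ℕ[X] := Cardinal.mk_le_aleph0_iff.1 (by simp)
  have : Finite Token := Set.finite_univ_iff.1 <| by
    refine Set.Finite.subset (Set.toFinite {.tick, .sep, .input, .proof, .ancilla, .had, .tgate,
      .cnot, .query, .queryInv, .cquery, .cqueryInv}) fun t _ => ?_
    cases t <;> simp
  have hD : D.Countable := Set.countable_univ.prod
    (Set.countable_univ.prod (countable_computableInPolyTime _))
  -- Baire category theorem for the countably many dense open sets `interior (fooled d)`.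
  obtain ⟨O, hO⟩ := (dense_biInter_of_isOpen (fun d _ => isOpen_interior) hD
    fun d _ => dense_interior_fooled d).nonempty
  refine ⟨O, ?_⟩
  rintro ⟨V, hV⟩
  have hmem := Set.mem_iInter₂.1 hO ⟨V.proofLen, V.ancillas, fun n => encodeCircuit (V.circuit n)⟩
    ⟨trivial, trivial, V.uniform⟩
  exact interior_subset hmem V rfl rfl rfl hV

end

end QOracle

theorem theorem2 : ∃ U : QOracle.QuantumOracle, ¬ (QOracle.SBQP U ⊆ QOracle.QMA 2 U) := by
  obtain ⟨O, hO⟩ := QOracle.exists_imbalanceLanguage_notMem_QMA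
  exact ⟨QOracle.phaseOracle O, fun h => hO (h (QOracle.imbalanceLanguage_mem_SBQP O))⟩
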